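/- **Setting.** Let $\mathcal G$ be a finite connected graph (no loop edges, no multiple edges) with vertex set $X$ and edge set $E$. Let $C_{x,y}=C_{y,x}$ be conductances, positive on edges and $0$ otherwise, and let $\kappa_x\ge 0$ be killing rates, not all zero. Put $\lambda_x=\kappa_x+\sum_y C_{x,y}$ and $P^x_y=C_{x,y}/\lambda_x$. A (non-trivial) based loop is a closed path of positive length, and a loop is an orbit of based loops under the cyclic shift. The loop measure is $\mu(l)=\frac1{\mathrm{mult}(l)}\prod_{\text{edges }(x,y)\text{ of }l}P^x_y$, where $\mathrm{mult}(l)$ is the largest $m$ such that a based loop representing $l$ is the concatenation of $m$ identical based loops. For $\alpha\ge0$ let $\mathcal L_\alpha$ be the Poisson point process of loops (a random multiset) of intensity $\alpha\mu$. The degree of a loop is the supremum of the $n\geq 1$ such that its class in the fundamental group $\Gamma$ of $\mathcal G$ (closed paths at a base point up to insertion and erasure of backtrackings) lies in $\Gamma^{(n)}$, where $\Gamma^{(1)}=\Gamma$ and $\Gamma^{(n+1)}=[\Gamma^{(n)},\Gamma]$. Let $\mathcal L^{(>1)}_\alpha$ consist of the loops of $\mathcal L_\alpha$ of degree greater than one,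 i.e. those whose first homology class $h_1(l)\in\Gamma/[\Gamma,\Gamma]$ vanishes (loops homotopic to a point included). Fix a spanning tree and an orientation $e_1,\dots,e_r$ of the $r=|E|-|X|+1$ edges outside it. For a based loop let $N_{e,f}$ be the number of pairs of times $s<t$ at which it crosses the oriented edges $e$ and then $f$, and let $\check N_{i,j}=N_{e_i,e_j}+N_{-e_i,-e_j}-N_{e_i,-e_j}-N_{-e_i,e_j}$. For a loop $l$ of degree greater than one and $i<j$ this does not depend on the representing based loop and is written $\check N_{i,j}(l)$. For an odd prime $p$, let $G$ be the group of pairs $(a,c)$, $a\in(\mathbb Z/p)^r$, $c$ a skew-symmetric $r\times r$ matrix over $\mathbb Z/p$, with product $(a,c)(a',c')=(a+a',\,c+c'+\frac12(a\otimes a'-a'\otimes a))$. For a skew-symmetric $r\times r$ matrix $h$ over $\mathbb Z/p$, let $U_h$ be the representation of $G$ on the complex functions on $(\mathbb Z/p)^r$ given by $$U_h[(a,c)]\psi(x)=e^{\frac{2\pi\sqrt{-1}}p(\sum_{i,j}h_{i,j}c_{i,j}+\sum_i a_ix_i)}\,\psi(x-h\cdot a),\qquad (h\cdot a)_i=\sum_j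 h_{i,j}a_j .$$ Let $A[e_i]=(v_i,0)$ with $v_i$ the $i$-th canonical basis vector, $A[-e_i]=(-v_i,0)$, and $A=(0,0)$ on the oriented edges of the tree. Let $P^{(A,h)}$ be the square matrix of size $|X|\,p^r$ with blocks $P^x_y\,U_h[A[(x,y)]]$. For $u=(u_{i,j})_{i<j}\in[0,1]^{r(r-1)/2}$ let $h(u,p)$ be the skew-symmetric matrix over $\mathbb Z/p$ with $h(u,p)_{i,j}=\frac12\lfloor p\,u_{i,j}\rfloor$ for $i<j$. **Theorem.** For every $u\in[0,1]^{r(r-1)/2}$ the limit $$F(u)=\lim_{p\to\infty}\frac1{p^r}\log\det\bigl(I-P^{(A,h(u,p))}\bigr)$$ along the odd primes exists, and $F$ is integrable. The numbers $|\{l\in\mathcal L^{(>1)}_\alpha:\ \check N_{i,j}(l)=m_{i,j}\ \text{for all}\ i<j\}|$ of loops (counted with their occurrences), for all families of integers $m=(m_{i,j})_{1\le i<j\le r}$, are independent Poisson variables, with expectations $$\alpha\,\mu(\{l:\ h_1(l)=0,\ \check N_{i,j}(l)=m_{i,j},\ i<j\})=-\alpha\int_{[0,1]^{r(r-1)/2}}F(u)\prod_{i<j}e^{-2\pi\sqrt{-1}\,m_{i,j}u_{i,j}}\,du_{i,j}.$$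 -/

import Mathlib

open MeasureTheory ProbabilityTheory Filter Topology
open scoped ENNReal NNReal

noncomputable section

namespace LoopEnsemble

/-! ### The fundamental group of a graph -/

section FundamentalGroup

variable {V : Type*} {G : SimpleGraph V}

/-- `p` and `q` differ by the erasure of one backtracking `u → v → u`. -/
inductive BacktrackErasure {x y : V} : G.Walk x y → G.Walk x y → Prop
  | erase {u v : V} (p : G.Walk x u) (h : G.Adj u v) (q : G.Walk u y) :
      BacktrackErasure (p.append (.cons h (.cons h.symm q))) (p.append q)

/-- Homotopy of walks with fixed endpoints: the equivalence relation generated by the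
insertion and the erasure of backtrackings. -/
def Homotopic {x y : V} (p q : G.Walk x y) : Prop :=
  Relation.EqvGen BacktrackErasure p q

theorem Homotopic.refl {x y : V} (p : G.Walk x y) : Homotopic p p :=
  Relation.EqvGen.refl p

theorem Homotopic.symm {x y : V} {p q : G.Walk x y} (h : Homotopic p q) : Homotopic q p :=
  Relation.EqvGen.symm _ _ h

theorem Homotopic.trans {x y : V} {p q r : G.Walk x y} (h : Homotopic p q)
    (h' : Homotopic q r) : Homotopic p r :=
  Relation.EqvGen.trans _ _ _ h h'

theorem Homotopic.map {x y x' y' : V} (f : G.Walk x y → G.Walk x' y')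
    (hf : ∀ p q, BacktrackErasure p q → BacktrackErasure (f p) (f q)) {p q : G.Walk x y}
    (h : Homotopic p q) : Homotopic (f p) (f q) := by
  induction h with
  | rel p q h => exact Relation.EqvGen.rel _ _ (hf p q h)
  | refl p => exact Homotopic.refl _
  | symm p q _ ih => exact ih.symm
  | trans p q r _ _ ih ih' => exact ih.trans ih'

theorem Homotopic.append_right {x y z : V} {p q : G.Walk x y} (h : Homotopic p q)
    (r : G.Walk y z) : Homotopic (p.append r) (q.append r) := by
  refine Homotopic.map (fun w => w.append r) ?_ h
  rintro _ _ ⟨a, e, b⟩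
  simp only [← SimpleGraph.Walk.append_assoc, SimpleGraph.Walk.cons_append]
  exact BacktrackErasure.erase a e (b.append r)

theorem Homotopic.append_left {x y z : V} {p q : G.Walk y z} (r : G.Walk x y)
    (h : Homotopic p q) : Homotopic (r.append p) (r.append q) := by
  refine Homotopic.map (fun w => r.append w) ?_ h
  rintro _ _ ⟨a, e, b⟩
  simp only [SimpleGraph.Walk.append_assoc]
  exact BacktrackErasure.erase (r.append a) e b

theorem Homotopic.reverse {x y : V} {p q : G.Walk x y} (h : Homotopic p q) :
    Homotopic p.reverse q.reverse := by
  refine Homotopic.map (fun w => w.reverse) ?_ h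
  rintro _ _ ⟨a, e, b⟩
  simp only [SimpleGraph.Walk.reverse_append, SimpleGraph.Walk.reverse_cons,
    ← SimpleGraph.Walk.append_assoc, SimpleGraph.Walk.cons_append, SimpleGraph.Walk.nil_append]
  exact BacktrackErasure.erase b.reverse e a.reverse

theorem homotopic_reverse_append {x y : V} (p : G.Walk x y) :
    Homotopic (p.reverse.append p) .nil := by
  induction p with
  | nil => exact Homotopic.refl _
  | cons h p ih =>
    refine Homotopic.trans (Relation.EqvGen.rel _ _ ?_) ih
    simp only [SimpleGraph.Walk.reverse_cons, ← SimpleGraph.Walk.append_assoc,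
      SimpleGraph.Walk.cons_append, SimpleGraph.Walk.nil_append]
    exact BacktrackErasure.erase p.reverse h.symm p

/-- Homotopy of closed walks at `x`. -/
def homotopySetoid (G : SimpleGraph V) (x : V) : Setoid (G.Walk x x) where
  r := Homotopic
  iseqv := ⟨Homotopic.refl, Homotopic.symm, Homotopic.trans⟩

/-- The fundamental group of the graph `G` at `x`: closed walks at `x` modulo homotopy,
with concatenation as composition. -/
def FundamentalGroup (G : SimpleGraph V) (x : V) : Type _ :=
  Quotient (homotopySetoid G x)

/-- The homotopy class of a closed walk. -/
def homotopyClass {x : V} (p : G.Walk x x) : FundamentalGroup G x :=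
  Quotient.mk (homotopySetoid G x) p

instance (x : V) : Group (FundamentalGroup G x) where
  mul := Quotient.map₂ (fun p q => p.append q)
    fun _ b h a' _ h' => (Homotopic.append_right h a').trans (Homotopic.append_left b h')
  one := homotopyClass .nil
  inv := Quotient.map (fun p => p.reverse) fun _ _ h => Homotopic.reverse h
  mul_assoc := by
    rintro ⟨a⟩ ⟨b⟩ ⟨c⟩
    exact congrArg homotopyClass (SimpleGraph.Walk.append_assoc a b c).symm
  one_mul := by
    rintro ⟨a⟩
    exact congrArg homotopyClass (SimpleGraph.Walk.nil_append a)
  mul_one := by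
    rintro ⟨a⟩
    exact congrArg homotopyClass (SimpleGraph.Walk.append_nil a)
  inv_mul_cancel := by
    rintro ⟨a⟩
    exact Quotient.sound (homotopic_reverse_append a)

end FundamentalGroup

/-! ### Based loops, loops, crossing numbers, degree -/

section Loops

variable {V : Type*}

/-- A (non-trivial) based loop: a closed walk of positive length. -/
structure BasedLoop (G : SimpleGraph V) where
  base : V
  walk : G.Walk base base
  length_pos : 0 < walk.length

/-- The list of the oriented edges which a based loop successively crosses. -/
def BasedLoop.darts {G : SimpleGraph V} (w : BasedLoop G) : List G.Dart := w.walk.darts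

/-- Two based loops are equivalent if one is obtained from the other by iterating the shift, i.e.
by a cyclic permutation of the list of oriented edges. -/
def shiftSetoid (G : SimpleGraph V) : Setoid (BasedLoop G) :=
  (List.IsRotated.setoid G.Dart).comap BasedLoop.darts

/-- A loop is an orbit of based loops under the shift. -/
def Loop (G : SimpleGraph V) : Type _ := Quotient (shiftSetoid G)

/-- The loop defined by a based loop. -/
def BasedLoop.toLoop {G : SimpleGraph V} (w : BasedLoop G) : Loop G :=
  Quotient.mk (shiftSetoid G) w

instance (G : SimpleGraph V) : MeasurableSpace (Loop G) := ⊤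

/-- The multiplicity of a loop: the largest `m` such that (a based loop representing) the loop is
the concatenation of `m` identical based loops. -/
def Loop.mult {G : SimpleGraph V} (l : Loop G) : ℕ :=
  sSup {m : ℕ | ∃ w : BasedLoop G, w.toLoop = l ∧
    ∃ q : G.Walk w.base w.base, w.darts = (List.replicate m q.darts).flatten}

/-- The degree of a loop: the supremum of the `n ≥ 1` such that the class of the loop in the
fundamental group lies in the term `Γ⁽ⁿ⁾` of the lower central series
(`Γ⁽¹⁾ = Γ`, `Γ⁽ⁿ⁺¹⁾ = [Γ⁽ⁿ⁾, Γ]`; Mathlib numbers it from `0`).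
It is `⊤` for a loop that is homotopic to a point. -/
def Loop.degree {G : SimpleGraph V} (l : Loop G) : ℕ∞ :=
  sSup {n : ℕ∞ | ∃ k : ℕ, n = (k + 1 : ℕ) ∧ ∃ w : BasedLoop G, w.toLoop = l ∧
    homotopyClass w.walk ∈ (⊤ : Subgroup (FundamentalGroup G w.base)).lowerCentralSeries k}

/-- `N_{e,f}`: the number of pairs of times `s < t` at which the based loop crosses `e` and
then `f`. -/
def BasedLoop.crossings [DecidableEq V] {G : SimpleGraph V} (w : BasedLoop G)
    (e f : G.Dart) : ℕ :=
  (Finset.univ.filter fun st : Fin w.darts.length × Fin w.darts.length =>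
    st.1 < st.2 ∧ w.darts.get st.1 = e ∧ w.darts.get st.2 = f).card

/-- `Ň_{e,f} = N_{e,f} + N_{-e,-f} - N_{e,-f} - N_{-e,f}`. -/
def BasedLoop.current₂ [DecidableEq V] {G : SimpleGraph V} (w : BasedLoop G)
    (e f : G.Dart) : ℤ :=
  (w.crossings e f : ℤ) + w.crossings e.symm f.symm - w.crossings e f.symm - w.crossings e.symm f

/-- The pairs of indices `(i, j)` with `i < j`. -/
abbrev Pairs (r : ℕ) : Type := {ij : Fin r × Fin r // ij.1 < ij.2}

/-- The loops `l` of degree greater than one with `Ň_{i,j}(l) = m_{i,j}` for all `i < j`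
(for all based loops representing `l`). -/
def loopsWith [DecidableEq V] {G : SimpleGraph V} {r : ℕ} (e : Fin r → G.Dart)
    (m : Pairs r → ℤ) : Set (Loop G) :=
  {l | 1 < l.degree ∧ ∀ w : BasedLoop G, w.toLoop = l →
    ∀ ij : Pairs r, w.current₂ (e ij.1.1) (e ij.1.2) = m ij}

end Loops

/-! ### The loop measure and the Poissonian ensembles of loops -/

section LoopMeasure

variable {V : Type*} [Fintype V]

/-- Positive conductances on the edges (extended by zero) and non-negative killing rates on
the vertices, the killing being not identically zero. -/
structure Weights (G : SimpleGraph V) where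
  cond : V → V → ℝ
  cond_symm : ∀ x y, cond x y = cond y x
  cond_pos : ∀ x y, G.Adj x y → 0 < cond x y
  cond_zero : ∀ x y, ¬ G.Adj x y → cond x y = 0
  kill : V → ℝ
  kill_nonneg : ∀ x, 0 ≤ kill x
  kill_ne_zero : ∃ x, kill x ≠ 0

variable {G : SimpleGraph V} (W : Weights G)

/-- The duality measure `λ_x = κ_x + ∑_y C_{x,y}`. -/
def Weights.duality (x : V) : ℝ := W.kill x + ∑ y, W.cond x y

/-- The transition matrix `P^x_y = C_{x,y} / λ_x`. -/
def Weights.transition (x y : V) : ℝ := W.cond x y / W.duality x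

/-- The product of the transition probabilities along the edges of a loop. -/
def Loop.prod (l : Loop G) : ℝ :=
  Quotient.lift
    (fun w : BasedLoop G => (w.darts.map fun d => W.transition d.fst d.snd).prod)
    (fun _ _ h => ((List.IsRotated.perm h).map _).prod_eq) l

/-- `μ({l})`, the mass given to the loop `l` by the loop measure. -/
def Loop.weight (l : Loop G) : ℝ≥0 := Real.toNNReal ((1 / (l.mult : ℝ)) * l.prod W)

/-- The loop measure `μ`. -/
def loopMeasure : Measure (Loop G) :=
  Measure.sum fun l : Loop G => (l.weight W : ℝ≥0∞) • Measure.dirac l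

/-- `N` describes a Poisson point process of loops of intensity `α μ` (a random multiset of loops,
in which `l` occurs `N l` times): as the space of loops is countable and discrete, this means that
the numbers of occurrences are independent Poisson variables with means `α μ({l})`. -/
structure IsPoissonEnsemble {Ω : Type*} [MeasurableSpace Ω] (Pr : Measure Ω) (α : ℝ≥0)
    (N : Loop G → Ω → ℕ) : Prop where
  measurable : ∀ l, Measurable (N l)
  law : ∀ l, HasLaw (N l) (poissonMeasure (α * l.weight W)) Pr
  indep : iIndepFun N Pr

/-- The number of loops of the ensemble, counted with their occurrences, which belong to `A`. -/
def count {Ω : Type*} (N : Loop G → Ω → ℕ) (A : Set (Loop G)) (ω : Ω) : ℝ≥0∞ :=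
  ∑' l : A, (N l ω : ℝ≥0∞)

end LoopMeasure

/-! ### The nilpotent group and its representations -/

section Nilpotent

/-- The elements `(a, c)` of the nilpotent group: `a` is a vector and `c` a skew-symmetric matrix
with coefficients in `ℤ/p`. -/
@[ext]
structure NilGroup (r p : ℕ) where
  a : Fin r → ZMod p
  c : Matrix (Fin r) (Fin r) (ZMod p)
  skew : c.transpose = -c

variable {r p : ℕ}

/-- `(a,c)(a',c') = (a + a', c + c' + ½ (a ⊗ a' - a' ⊗ a))`. -/
instance : Mul (NilGroup r p) where
  mul g g' :=
    { a := g.a + g'.a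
      c := g.c + g'.c + (2 : ZMod p)⁻¹ •
        (Matrix.vecMulVec g.a g'.a - Matrix.vecMulVec g'.a g.a)
      skew := by
        rw [Matrix.transpose_add, Matrix.transpose_add, g.skew, g'.skew]
        ext i j
        simp [Matrix.vecMulVec_apply]
        ring }

instance : One (NilGroup r p) where
  one := { a := 0, c := 0, skew := by simp }

instance : Inv (NilGroup r p) where
  inv g := { a := -g.a, c := -g.c, skew := by rw [Matrix.transpose_neg, g.skew] }

theorem NilGroup.mul_a (g g' : NilGroup r p) : (g * g').a = g.a + g'.a := rfl

theorem NilGroup.mul_c (g g' : NilGroup r p) : (g * g').c = g.c + g'.c + (2 : ZMod p)⁻¹ •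
    (Matrix.vecMulVec g.a g'.a - Matrix.vecMulVec g'.a g.a) := rfl

theorem NilGroup.one_a : (1 : NilGroup r p).a = 0 := rfl

theorem NilGroup.one_c : (1 : NilGroup r p).c = 0 := rfl

theorem NilGroup.inv_a (g : NilGroup r p) : (g⁻¹).a = -g.a := rfl

theorem NilGroup.inv_c (g : NilGroup r p) : (g⁻¹).c = -g.c := rfl

instance : Group (NilGroup r p) where
  mul_assoc g g' g'' := by
    ext i j
    · simp only [NilGroup.mul_a, Pi.add_apply]; ring
    · simp only [NilGroup.mul_c, NilGroup.mul_a, Matrix.add_apply, Matrix.smul_apply,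
        Matrix.sub_apply, Matrix.vecMulVec_apply, Pi.add_apply, smul_eq_mul]
      ring
  one_mul g := by
    ext i j
    · simp [NilGroup.mul_a, NilGroup.one_a]
    · simp [NilGroup.mul_c, NilGroup.one_a, NilGroup.one_c]
  mul_one g := by
    ext i j
    · simp [NilGroup.mul_a, NilGroup.one_a]
    · simp [NilGroup.mul_c, NilGroup.one_a, NilGroup.one_c]
  inv_mul_cancel g := by
    ext i j
    · simp [NilGroup.mul_a, NilGroup.inv_a, NilGroup.one_a]
    · simp [NilGroup.mul_c, NilGroup.inv_a, NilGroup.inv_c, NilGroup.one_c]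

/-- The operator `U_h[(a,c)] ψ (x) = exp (2π√-1/p (⟨c,h⟩ + ⟨a,x⟩)) ψ (x - h·a)` on the space of
functions on `(ℤ/p)^r`, with `⟨c,h⟩ = ∑_{i,j} h_{i,j} c_{i,j}`. -/
def schrodinger [NeZero p] (h : Matrix (Fin r) (Fin r) (ZMod p)) (g : NilGroup r p) :
    ((Fin r → ZMod p) → ℂ) →ₗ[ℂ] ((Fin r → ZMod p) → ℂ) where
  toFun ψ x := ZMod.stdAddChar (∑ i, ∑ j, h i j * g.c i j + ∑ i, g.a i * x i) *
    ψ (x - h.mulVec g.a)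
  map_add' ψ φ := by ext x; simp [mul_add]
  map_smul' t ψ := by ext x; simp; ring

/-- `U_h` is a representation, when `h` is skew-symmetric and `p` is an odd prime. -/
theorem schrodinger_mul [Fact p.Prime] (hp : p ≠ 2) {h : Matrix (Fin r) (Fin r) (ZMod p)}
    (hh : h.transpose = -h) (g g' : NilGroup r p) :
    schrodinger h (g * g') = schrodinger h g ∘ₗ schrodinger h g' := by
  have h2 : (2 : ZMod p) ≠ 0 := by
    intro h0
    have h1 : ((2 : ℕ) : ZMod p) = 0 := by exact_mod_cast h0
    rw [ZMod.natCast_eq_zero_iff] at h1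
    exact hp ((Nat.prime_dvd_prime_iff_eq Fact.out Nat.prime_two).1 h1)
  have hskew : ∀ i j, h j i = - h i j := fun i j => by
    have := congrFun (congrFun hh i) j
    simpa using this
  have hswap : ∑ i, ∑ j, h i j * (g.a i * g'.a j) = - ∑ i, ∑ j, h i j * (g'.a i * g.a j) := by
    rw [Finset.sum_comm, ← Finset.sum_neg_distrib]
    refine Finset.sum_congr rfl fun i _ => ?_
    rw [← Finset.sum_neg_distrib]
    refine Finset.sum_congr rfl fun j _ => ?_
    rw [hskew i j]; ring
  have hlin : ∑ i, g'.a i * (h.mulVec g.a) i = ∑ i, ∑ j, h i j * (g'.a i * g.a j) := by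
    refine Finset.sum_congr rfl fun i _ => ?_
    rw [Matrix.mulVec, dotProduct, Finset.mul_sum]
    exact Finset.sum_congr rfl fun j _ => by ring
  have hc : ∑ i, ∑ j, h i j * (g * g').c i j =
      ∑ i, ∑ j, h i j * g.c i j + ∑ i, ∑ j, h i j * g'.c i j
        - ∑ i, g'.a i * (h.mulVec g.a) i := by
    have hhalf : ∀ i j, h i j * (g * g').c i j = h i j * g.c i j + h i j * g'.c i j +
        (2 : ZMod p)⁻¹ * (h i j * (g.a i * g'.a j) - h i j * (g'.a i * g.a j)) := fun i j => by
      simp only [NilGroup.mul_c, Matrix.add_apply, Matrix.smul_apply, Matrix.sub_apply,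
        Matrix.vecMulVec_apply, smul_eq_mul]
      ring
    simp only [hhalf, Finset.sum_add_distrib, ← Finset.mul_sum, Finset.sum_sub_distrib]
    rw [hswap, hlin]
    field_simp
    ring
  ext1 ψ
  ext x
  simp only [schrodinger, LinearMap.coe_mk, AddHom.coe_mk, LinearMap.comp_apply, hc]
  rw [← mul_assoc, ← AddChar.map_add_eq_mul]
  congr 1
  · congr 1
    simp only [NilGroup.mul_a, Pi.add_apply, Pi.sub_apply, add_mul, mul_sub,
      Finset.sum_add_distrib, Finset.sum_sub_distrib]
    ring
  · rw [NilGroup.mul_a, Matrix.mulVec_add, sub_sub]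

/-- The skew-symmetric matrix `h(u,p)` with coefficients `h_{i,j} = ½ ⌊p u_{i,j}⌋` in `ℤ/p`, for
`i < j`. The factor `½` is the one which makes the pairing
`⟨c,h⟩ = ∑_{i,j} h_{i,j} c_{i,j}` equal to `∑_{i<j} ⌊p u_{i,j}⌋ c_{i,j}`. -/
def skewOf (p : ℕ) (u : Pairs r → ℝ) : Matrix (Fin r) (Fin r) (ZMod p) := fun i j =>
  if hij : i < j then (2 : ZMod p)⁻¹ * (⌊(p : ℝ) * u ⟨(i, j), hij⟩⌋ : ZMod p)
  else if hji : j < i then -((2 : ZMod p)⁻¹ * (⌊(p : ℝ) * u ⟨(j, i), hji⟩⌋ : ZMod p))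
  else 0

variable {V : Type*} [Fintype V] [DecidableEq V] {G : SimpleGraph V}

/-- The connection `A`: `e_i` is mapped to `(v_i, 0)`, `-e_i` to `(-v_i, 0)`, and the other
oriented edges, which are those of the spanning tree, to the neutral element. It is written on
pairs of vertices, through `η^i_{x,y} = 1_{(x,y) = e_i} - 1_{(y,x) = e_i}`. -/
def connection (p : ℕ) (e : Fin r → G.Dart) (x y : V) : NilGroup r p where
  a i := (if (x, y) = (e i).toProd then 1 else 0) - (if (y, x) = (e i).toProd then 1 else 0)
  c := 0
  skew := by simp

/-- The matrix `P^{(A,h)}`, indexed by `V` times a basis of the space of the representation `U_h`,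
with blocks `P^x_y U_h[A(x,y)]`. -/
def extendedTransition [NeZero p] (W : Weights G) (e : Fin r → G.Dart)
    (h : Matrix (Fin r) (Fin r) (ZMod p)) :
    Matrix (V × (Fin r → ZMod p)) (V × (Fin r → ZMod p)) ℂ := fun s t =>
  (W.transition s.1 t.1 : ℂ) *
    LinearMap.toMatrix' (schrodinger h (connection p e s.1 t.1)) s.2 t.2

/-- The odd prime numbers. -/
abbrev OddPrime : Type := {p : ℕ // p.Prime ∧ p ≠ 2}

instance (p : OddPrime) : NeZero (p : ℕ) := ⟨p.2.1.ne_zero⟩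

/-- `p^{-r} log det (I - P^{(A,h(u,p))})`. -/
def normalizedLogDet (W : Weights G) (e : Fin r → G.Dart) (u : Pairs r → ℝ) (p : OddPrime) : ℂ :=
  (1 / ((p : ℕ) : ℂ) ^ r) *
    Complex.log (1 - extendedTransition W e (skewOf (p : ℕ) u)).det

end Nilpotent

end LoopEnsemble

end

/-! Conjugating by the square root of the duality measure makes `P^{(A,h)}` Hermitian, because the
conductances are symmetric, `U_h` is unitary and the connection is inverted when an edge is
reversed. Killing makes the traces of its powers tend to zero, so its eigenvalues lie in (-1, 1) and
-log det(I - P^{(A,h)}) = ∑ tr((P^{(A,h)})^n)/n. Read over closed walks, this is the sum over based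
loops of (product of transitions)/(length) times the trace of `U_h` at the holonomy
(`hasSum_log_det`).

That trace vanishes unless all fluxes through the `e_i` vanish mod p. If they vanish in ℤ, the
holonomy is central with coordinates Ň_{i,j}, and the trace is p^r exp(2πi ∑_{i<j} (⌊p u_{i,j}⌋/p)
Ň_{i,j}). A fixed nonzero flux is not divisible by large p. Dominated convergence therefore gives
F(u) = -∑ weight · 1_{flux = 0} · exp(2πi ∑ u_{i,j} Ň_{i,j}) (`tendsto_normalizedLogDet`), and the
Fourier coefficients of F isolate the based loops with Ň = m (`integral_limitLogDet`).

Two translations remain. A loop has degree greater than one exactly when its fluxes vanish, since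
the spanning tree reduces the abelianized group to the generators `e_i` (`one_lt_degree_iff`). The
weights of the based loops representing a loop add up to its mass under μ (`tsum_fiber_weight`). The
probabilistic statement is then the superposition and restriction property of Poisson variables on
disjoint sets of loops. -/

noncomputable section

namespace LoopEnsemble

/-! ### Fluxes, discrete areas and the holonomy of a list of oriented edges. -/

section DartLists

variable {V : Type*} [DecidableEq V] {G : SimpleGraph V}

/-- The signed crossing `1_{d = e} - 1_{d = -e}` of the oriented edge `e` by `d`. -/
def signedCrossing (e d : G.Dart) : ℤ := (if d = e then 1 else 0) - (if d = e.symm then 1 else 0)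

/-- The algebraic number of crossings of `e` in a list of oriented edges. -/
def flux (e : G.Dart) (L : List G.Dart) : ℤ := (L.map (signedCrossing e)).sum

/-- The sum over the pairs of times `s < t` of the products of the signed crossings of `e` at `s`
and of `f` at `t`. -/
def area (e f : G.Dart) : List G.Dart → ℤ
  | [] => 0
  | d :: L => signedCrossing e d * flux f L + area e f L

@[simp] theorem flux_nil (e : G.Dart) : flux e [] = 0 := rfl

@[simp] theorem flux_cons (e d : G.Dart) (L : List G.Dart) :
    flux e (d :: L) = signedCrossing e d + flux e L := by simp [flux]

theorem flux_append (e : G.Dart) (L L' : List G.Dart) :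
    flux e (L ++ L') = flux e L + flux e L' := by simp [flux]

@[simp] theorem area_nil (e f : G.Dart) : area e f [] = 0 := rfl

@[simp] theorem area_cons (e f d : G.Dart) (L : List G.Dart) :
    area e f (d :: L) = signedCrossing e d * flux f L + area e f L := rfl

theorem area_append (e f : G.Dart) (L L' : List G.Dart) :
    area e f (L ++ L') = area e f L + area e f L' + flux e L * flux f L' := by
  induction L with
  | nil => simp
  | cons d L ih => simp [ih, flux_append]; ring

theorem signedCrossing_symm (e d : G.Dart) : signedCrossing e d.symm = - signedCrossing e d := by
  have h1 : d.symm = e ↔ d = e.symm := by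
    constructor <;> intro h
    · rw [← h, SimpleGraph.Dart.symm_symm]
    · rw [h, SimpleGraph.Dart.symm_symm]
  have h2 : d.symm = e.symm ↔ d = e :=
    ⟨fun h => by simpa using congrArg SimpleGraph.Dart.symm h, fun h => by rw [h]⟩
  simp only [signedCrossing, h1, h2]; ring

theorem flux_eq_of_perm (e : G.Dart) {L L' : List G.Dart} (h : L.Perm L') :
    flux e L = flux e L' := (h.map _).sum_eq

/-- Turning AB into BA changes the area by flux_e(B) flux_f(A) - flux_e(A) flux_f(B), which is zero
when the total fluxes vanish. This is why Ň descends from based loops to loops of zero homology. -/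
theorem area_eq_of_isRotated {e f : G.Dart} {L L' : List G.Dart} (h : L ~r L')
    (he : flux e L = 0) (hf : flux f L = 0) : area e f L' = area e f L := by
  obtain ⟨n, hn, rfl⟩ := List.isRotated_iff_mod.1 h
  rw [List.rotate_eq_drop_append_take hn]
  nth_rw 1 [← List.take_append_drop n L] at he hf
  nth_rw 3 [← List.take_append_drop n L]
  rw [flux_append] at he hf
  rw [area_append, area_append]
  linear_combination (flux f (L.take n)) * he - (flux e (L.take n)) * hf

/-- The double sum over pairs of times is split into s < t, s > t and s = t. -/
theorem flux_mul_flux (e f : G.Dart) (L : List G.Dart) :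
    flux e L * flux f L = area e f L + area f e L +
      (L.map fun d => signedCrossing e d * signedCrossing f d).sum := by
  induction L with
  | nil => simp
  | cons d L ih =>
    simp only [flux_cons, area_cons, List.map_cons, List.sum_cons]
    linear_combination ih

/-- No oriented edge contributes to the diagonal term, as it cannot lie over two distinct edges. The
vanishing flux then makes the two areas opposite. -/
theorem area_swap {e f : G.Dart} (hef : e.edge ≠ f.edge) {L : List G.Dart}
    (he : flux e L = 0) : area f e L = - area e f L := by
  have h := flux_mul_flux e f L
  have h0 : (L.map fun d => signedCrossing e d * signedCrossing f d).sum = 0 := by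
    apply List.sum_eq_zero
    intro x hx
    obtain ⟨d, -, rfl⟩ := List.mem_map.1 hx
    unfold signedCrossing
    have h1 : ∀ {a b : G.Dart}, a.edge ≠ b.edge → a ≠ b := fun h h' => h (by rw [h'])
    have h2 : ∀ a : G.Dart, d.edge ≠ a.edge → d ≠ a.symm := fun a h h' =>
      h (by rw [h', SimpleGraph.Dart.edge_symm])
    by_cases hd : d.edge = e.edge
    · have hd' : d.edge ≠ f.edge := fun h => hef (hd.symm.trans h)
      rw [if_neg (h1 hd'), if_neg (h2 f hd')]
      simp
    · rw [if_neg (h1 hd), if_neg (h2 e hd)]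
      simp
  rw [he, h0] at h
  linarith

/-- The number of pairs of times `s < t` at which a list visits `e` and then `f`. -/
def pairCount {α : Type*} [DecidableEq α] (L : List α) (e f : α) : ℕ :=
  (Finset.univ.filter fun st : Fin L.length × Fin L.length =>
    st.1 < st.2 ∧ L.get st.1 = e ∧ L.get st.2 = f).card

theorem pairCount_cons {α : Type*} [DecidableEq α] (d : α) (L : List α) (e f : α) :
    pairCount (d :: L) e f = (if d = e then L.count f else 0) + pairCount L e f := by
  simp only [pairCount, Finset.card_filter, Fintype.sum_prod_type, List.length_cons,
    Fin.sum_univ_succ]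
  have hc : L.count f = ∑ x : Fin L.length, if L.get x = f then 1 else 0 := by
    clear d e
    induction L with
    | nil => simp
    | cons d L ih =>
      rw [List.count_cons, ih]
      change _ = ∑ x : Fin (L.length + 1), if (d :: L).get x = f then 1 else 0
      rw [Fin.sum_univ_succ, add_comm]
      congr 1
      by_cases h : d = f <;> simp [h]
  rw [hc]
  by_cases h : d = e <;> simp [h]

theorem current₂_eq_area (w : BasedLoop G) (e f : G.Dart) :
    w.current₂ e f = area e f w.darts := by
  have hflux : ∀ (f : G.Dart) (L : List G.Dart), flux f L = L.count f - L.count f.symm := by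
    intro f L
    induction L with
    | nil => simp
    | cons d L ih =>
      rw [flux_cons, ih, List.count_cons, List.count_cons, signedCrossing]
      simp only [beq_iff_eq]
      push_cast; ring
  -- `crossings` is `pairCount` of the list of oriented edges by definition, and the latter can be
  -- computed by recursion on the list.
  suffices h : ∀ L : List G.Dart, (pairCount L e f : ℤ) + pairCount L e.symm f.symm
      - pairCount L e f.symm - pairCount L e.symm f = area e f L from h w.darts
  intro L
  induction L with
  | nil => simp [pairCount]
  | cons d L ih =>
    rw [area_cons, ← ih, hflux, signedCrossing]
    simp only [pairCount_cons]
    push_cast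
    split_ifs <;> push_cast <;> ring

theorem flux_eq_flux {L L' : List G.Dart} (h : L ~r L') (e : G.Dart) : flux e L = flux e L' :=
  flux_eq_of_perm e h.perm

/-- The product of the connection along a list of oriented edges. -/
def holonomy {r : ℕ} (p : ℕ) (e : Fin r → G.Dart) (L : List G.Dart) : NilGroup r p :=
  (L.map fun d => connection p e d.fst d.snd).prod

theorem connection_a {r : ℕ} (p : ℕ) (e : Fin r → G.Dart) (d : G.Dart) (i : Fin r) :
    (connection p e d.fst d.snd).a i = (signedCrossing (e i) d : ZMod p) := by
  have h1 : (d.fst, d.snd) = (e i).toProd ↔ d = e i :=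
    ⟨fun h => SimpleGraph.Dart.ext _ _ h, fun h => by rw [h]⟩
  have h2 : (d.snd, d.fst) = (e i).toProd ↔ d = (e i).symm := by
    constructor
    · intro h
      have h' : d.symm = e i := SimpleGraph.Dart.ext _ _ h
      rw [← h', SimpleGraph.Dart.symm_symm]
    · intro h
      rw [h]; rfl
  simp only [connection, signedCrossing, h1, h2]
  push_cast
  rfl

theorem holonomy_a {r : ℕ} (p : ℕ) (e : Fin r → G.Dart) (L : List G.Dart) (i : Fin r) :
    (holonomy p e L).a i = (flux (e i) L : ZMod p) := by
  induction L with
  | nil => simp [holonomy, NilGroup.one_a]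
  | cons d L ih =>
    rw [holonomy, List.map_cons, List.prod_cons, ← holonomy, NilGroup.mul_a, Pi.add_apply, ih,
      connection_a, flux_cons]
    push_cast; rfl

/-- Each factor has zero central part, so the central coordinate comes from the cocycle ½(a ⊗ a' -
a' ⊗ a) alone, with a the current edge and a' the flux of the remaining list. -/
theorem holonomy_c {r : ℕ} (p : ℕ) (e : Fin r → G.Dart) (L : List G.Dart) (i j : Fin r) :
    (holonomy p e L).c i j =
      (2 : ZMod p)⁻¹ * ((area (e i) (e j) L : ZMod p) - (area (e j) (e i) L : ZMod p)) := by
  induction L with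
  | nil => simp [holonomy, NilGroup.one_c]
  | cons d L ih =>
    rw [holonomy, List.map_cons, List.prod_cons, ← holonomy, NilGroup.mul_c, Matrix.add_apply,
      Matrix.add_apply, ih, Matrix.smul_apply, Matrix.sub_apply, Matrix.vecMulVec_apply,
      Matrix.vecMulVec_apply, holonomy_a, holonomy_a, connection_a, connection_a, area_cons,
      area_cons]
    simp only [connection, Matrix.zero_apply, smul_eq_mul]
    push_cast; ring

end DartLists

/-! ### Degree greater than one means vanishing fluxes. -/

section Degree

variable {V : Type*} {G T : SimpleGraph V}

theorem exists_isPath_homotopic (hT : T.IsAcyclic) {x y : V} (w : T.Walk x y) :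
    ∃ p : T.Walk x y, p.IsPath ∧ Homotopic w p := by
  classical
  induction w with
  | nil => exact ⟨.nil, SimpleGraph.Walk.IsPath.nil, Homotopic.refl _⟩
  | @cons u v y h w ih =>
    obtain ⟨p, hp, hwp⟩ := ih
    have hcons : Homotopic (.cons h w) (.cons h p) :=
      Homotopic.append_left (.cons h .nil) hwp
    by_cases hu : u ∈ p.support
    · cases p with
      | nil =>
        simp only [SimpleGraph.Walk.support_nil, List.mem_singleton] at hu
        exact absurd (hu ▸ h) (SimpleGraph.irrefl _)
      | @cons _ v' _ h' q =>
        -- By acyclicity, a path starting at a neighbour of `u` can meet `u` only at its first step,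
        -- so the added edge creates a backtracking.
        have hv' : u = v' := by
          simpa using hT.eq_snd_of_adj_start hp h.symm hu
        subst hv'
        refine ⟨q, hp.of_cons, hcons.trans (Relation.EqvGen.rel _ _ ?_)⟩
        exact BacktrackErasure.erase .nil h q
    · exact ⟨.cons h p, hp.cons hu, hcons⟩

theorem homotopic_of_isAcyclic (hT : T.IsAcyclic) {x y : V} (w w' : T.Walk x y) :
    Homotopic w w' := by
  obtain ⟨p, hp, h⟩ := exists_isPath_homotopic hT w
  obtain ⟨p', hp', h'⟩ := exists_isPath_homotopic hT w'
  have : p = p' := congrArg Subtype.val ((hT.subsingleton_path x y).elim ⟨p, hp⟩ ⟨p', hp'⟩)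
  exact h.trans (this ▸ h'.symm)

theorem Homotopic.mapLe (hTG : T ≤ G) {x y : V} {w w' : T.Walk x y} (h : Homotopic w w') :
    Homotopic (w.mapLe hTG) (w'.mapLe hTG) := by
  induction h with
  | rel p q h =>
    obtain ⟨a, e, b⟩ := h
    refine Relation.EqvGen.rel _ _ ?_
    rw [SimpleGraph.Walk.mapLe_append, SimpleGraph.Walk.mapLe_append]
    exact BacktrackErasure.erase (a.mapLe hTG) (hTG e) (b.mapLe hTG)
  | refl p => exact Homotopic.refl _
  | symm p q _ ih => exact ih.symm
  | trans p q r _ _ ih ih' => exact ih.trans ih'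

theorem homotopyClass_append {x : V} (p q : G.Walk x x) :
    homotopyClass (p.append q) = homotopyClass p * homotopyClass q := rfl

theorem homotopyClass_eq {x : V} {p q : G.Walk x x} (h : Homotopic p q) :
    homotopyClass p = homotopyClass q := Quotient.sound h

section Tree

variable (hTG : T ≤ G) (hT : T.IsTree)

/-- The class of the closed path which follows the tree from `b` to `x`, then `w`, then the tree
back to `b`. -/
def treeClass (b : V) {x y : V} (w : G.Walk x y) : FundamentalGroup G b :=
  homotopyClass ((((hT.connected.preconnected b x).some.mapLe hTG).append w).append
    ((hT.connected.preconnected b y).some.mapLe hTG).reverse)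

theorem treeClass_congr (b : V) {x y : V} {w w' : G.Walk x y} (h : Homotopic w w') :
    treeClass hTG hT b w = treeClass hTG hT b w' :=
  homotopyClass_eq ((h.append_left _).append_right _)

/-- The excursion back to `b` along the tree and out again cancels at the junction `y`. -/
theorem treeClass_append (b : V) {x y z : V} (w : G.Walk x y) (w' : G.Walk y z) :
    treeClass hTG hT b (w.append w') = treeClass hTG hT b w * treeClass hTG hT b w' := by
  unfold treeClass
  rw [← homotopyClass_append]
  refine homotopyClass_eq ?_
  generalize (hT.connected.preconnected b x).some.mapLe hTG = p
  generalize (hT.connected.preconnected b y).some.mapLe hTG = q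
  generalize (hT.connected.preconnected b z).some.mapLe hTG = s
  have h := ((homotopic_reverse_append q).append_right (w'.append s.reverse)).append_left
    (p.append w)
  simp only [SimpleGraph.Walk.append_assoc, SimpleGraph.Walk.nil_append] at h ⊢
  exact h.symm

theorem treeClass_mapLe (b : V) {x y : V} (w : T.Walk x y) :
    treeClass hTG hT b (w.mapLe hTG) = 1 := by
  refine homotopyClass_eq ?_
  have h := (homotopic_of_isAcyclic hT.isAcyclic
    (((hT.connected.preconnected b x).some.append w).append
      (hT.connected.preconnected b y).some.reverse) .nil).mapLe hTG
  rw [SimpleGraph.Walk.mapLe_append, SimpleGraph.Walk.mapLe_append,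
    ← SimpleGraph.Walk.reverse_mapLe] at h
  exact h

theorem treeClass_nil (b x : V) : treeClass hTG hT b (.nil : G.Walk x x) = 1 :=
  treeClass_mapLe hTG hT b (.nil : T.Walk x x)

theorem treeClass_symm (b : V) {x y : V} (h : G.Adj x y) :
    treeClass hTG hT b (.cons h.symm .nil) = (treeClass hTG hT b (.cons h .nil))⁻¹ := by
  rw [eq_inv_iff_mul_eq_one, ← treeClass_append, ← treeClass_nil hTG hT b y]
  exact treeClass_congr hTG hT b (Relation.EqvGen.rel _ _ (BacktrackErasure.erase .nil h.symm .nil))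

end Tree

variable [DecidableEq V]

/-- In a commutative group only the net number of occurrences of each generator matters. Every
oriented edge off the tree is exactly one `e i` or its reverse. -/
theorem prod_darts_eq {A : Type*} [CommGroup A] {r : ℕ} {e : Fin r → G.Dart}
    (he : Set.BijOn (fun i => (e i).edge) Set.univ (G.edgeSet \ T.edgeSet))
    (γ : G.Dart → A) (hsymm : ∀ d, γ d.symm = (γ d)⁻¹) (htree : ∀ d, d.edge ∈ T.edgeSet → γ d = 1)
    (L : List G.Dart) : (L.map γ).prod = ∏ i, γ (e i) ^ flux (e i) L := by
  induction L with
  | nil => simp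
  | cons d L ih =>
    simp only [List.map_cons, List.prod_cons, flux_cons, zpow_add, Finset.prod_mul_distrib, ih]
    congr 1
    have hne : ∀ i, d.edge ≠ (e i).edge → signedCrossing (e i) d = 0 := by
      intro i hi
      have h1 : d ≠ e i := fun h => hi (by rw [h])
      have h2 : d ≠ (e i).symm := fun h => hi (by rw [h, SimpleGraph.Dart.edge_symm])
      simp [signedCrossing, h1, h2]
    by_cases hd : d.edge ∈ T.edgeSet
    · rw [htree d hd, Finset.prod_eq_one]
      intro i _
      rw [hne i, zpow_zero]
      intro h
      exact (he.mapsTo (Set.mem_univ i)).2 (h ▸ hd)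
    · obtain ⟨i, -, hi⟩ := he.surjOn ⟨d.edge_mem, hd⟩
      rw [Finset.prod_eq_single i]
      · have hne' : e i ≠ (e i).symm := fun h => (SimpleGraph.Dart.symm_ne _) h.symm
        rcases (SimpleGraph.dart_edge_eq_iff _ _).1 hi with h | h
        · rw [← h, signedCrossing, if_pos rfl, if_neg hne']
          simp
        · have h' : d = (e i).symm := by rw [h, SimpleGraph.Dart.symm_symm]
          rw [h', signedCrossing, if_pos rfl, if_neg hne'.symm, hsymm]
          simp
      · intro j _ hj
        rw [hne j, zpow_zero]
        intro h
        exact hj (he.injOn (Set.mem_univ _) (Set.mem_univ _) (h.symm.trans hi.symm))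
      · simp

theorem flux_eq_of_homotopic (e : G.Dart) {x y : V} {p q : G.Walk x y} (h : Homotopic p q) :
    flux e p.darts = flux e q.darts := by
  induction h with
  | rel p q h =>
    obtain ⟨a, h, b⟩ := h
    have := signedCrossing_symm e ⟨(_, _), h⟩
    simp only [SimpleGraph.Walk.darts_append, SimpleGraph.Walk.darts_cons, flux_append, flux_cons]
    rw [← add_assoc (signedCrossing e _)]
    simp only [SimpleGraph.Dart.symm_mk, Prod.swap_prod_mk] at this
    rw [this]; ring
  | refl p => rfl
  | symm p q _ ih => exact ih.symm
  | trans p q r _ _ ih ih' => exact ih.trans ih'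

/-- The algebraic number of crossings of `e` as a morphism from the fundamental group to `ℤ`. -/
def fluxHom (e : G.Dart) (x : V) : FundamentalGroup G x →* Multiplicative ℤ :=
  MonoidHom.mk' (Quotient.lift (fun p => Multiplicative.ofAdd (flux e p.darts))
    fun _ _ h => congrArg Multiplicative.ofAdd (flux_eq_of_homotopic e h)) (by
      rintro ⟨a⟩ ⟨b⟩
      change Multiplicative.ofAdd (flux e (a.append b).darts) = _
      rw [SimpleGraph.Walk.darts_append, flux_append]
      rfl)

/-- A flux is a morphism to an abelian group, hence kills commutators. Conversely, in the
abelianization the class is the product of the classes of the `e i` raised to the fluxes. -/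
theorem homotopyClass_mem_commutator_iff {r : ℕ} {e : Fin r → G.Dart}
    (hTG : T ≤ G) (hT : T.IsTree)
    (he : Set.BijOn (fun i => (e i).edge) Set.univ (G.edgeSet \ T.edgeSet))
    {b : V} (w : G.Walk b b) :
    homotopyClass w ∈ commutator (FundamentalGroup G b) ↔ ∀ i, flux (e i) w.darts = 0 := by
  constructor
  · intro h i
    have := Abelianization.commutator_subset_ker (fluxHom (e i) b) h
    exact this
  · intro h
    rw [← Abelianization.ker_of, MonoidHom.mem_ker]
    let γ : G.Dart → Abelianization (FundamentalGroup G b) := fun d =>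
      Abelianization.of (treeClass hTG hT b (.cons d.adj .nil))
    have hγ : ∀ {x y : V} (w : G.Walk x y),
        Abelianization.of (treeClass hTG hT b w) = (w.darts.map γ).prod := by
      intro x y w
      induction w with
      | nil => simp [treeClass_nil]
      | cons h w ih =>
        rw [SimpleGraph.Walk.darts_cons, List.map_cons, List.prod_cons, ← ih, ← map_mul,
          ← treeClass_append]
        rfl
    -- The chosen tree walk from `b` to `b` need not be trivial, but it acts by conjugation, which
    -- is invisible in the abelianization.
    have hconj : Abelianization.of (treeClass hTG hT b w) =
        Abelianization.of (homotopyClass w) := by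
      have : treeClass hTG hT b w =
          homotopyClass ((hT.connected.preconnected b b).some.mapLe hTG) * homotopyClass w *
          (homotopyClass ((hT.connected.preconnected b b).some.mapLe hTG))⁻¹ := rfl
      rw [this, map_mul, map_mul, map_inv, mul_inv_cancel_comm]
    rw [← hconj, hγ, prod_darts_eq he γ]
    · simp [h]
    · intro d
      simp only [γ, ← map_inv, ← treeClass_symm]
      rfl
    · intro d hd
      have := treeClass_mapLe hTG hT b (.cons (show T.Adj d.fst d.snd from hd) .nil)
      change Abelianization.of _ = 1
      rw [← map_one Abelianization.of, ← this]
      rfl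

theorem one_lt_degree_iff {r : ℕ} {e : Fin r → G.Dart} (hTG : T ≤ G) (hT : T.IsTree)
    (he : Set.BijOn (fun i => (e i).edge) Set.univ (G.edgeSet \ T.edgeSet)) (w : BasedLoop G) :
    1 < w.toLoop.degree ↔ ∀ i, flux (e i) w.darts = 0 := by
  rw [Loop.degree, lt_sSup_iff]
  constructor
  · rintro ⟨_, ⟨k, rfl, w', hw', hk⟩, h1⟩ i
    -- With numbering from zero, the index 1 is the commutator subgroup, and the series decreases.
    have hk1 : 1 ≤ k := by
      have : (1 : ℕ) < k + 1 := by exact_mod_cast h1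
      omega
    have hmem := Subgroup.lowerCentralSeries_antitone ⊤ hk1 hk
    rw [Subgroup.top_lowerCentralSeries_one] at hmem
    have := (homotopyClass_mem_commutator_iff hTG hT he w'.walk).1 hmem i
    rw [← this]
    exact (flux_eq_flux (Quotient.exact hw') (e i)).symm
  · intro h
    refine ⟨_, ⟨1, rfl, w, rfl, ?_⟩, by norm_num⟩
    rw [Subgroup.top_lowerCentralSeries_one]
    exact (homotopyClass_mem_commutator_iff hTG hT he w.walk).2 h

theorem toLoop_mem_loopsWith_iff {r : ℕ} {e : Fin r → G.Dart} (hTG : T ≤ G) (hT : T.IsTree)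
    (he : Set.BijOn (fun i => (e i).edge) Set.univ (G.edgeSet \ T.edgeSet)) (m : Pairs r → ℤ)
    (w : BasedLoop G) :
    w.toLoop ∈ loopsWith e m ↔ (∀ i, flux (e i) w.darts = 0) ∧
      ∀ ij : Pairs r, area (e ij.1.1) (e ij.1.2) w.darts = m ij := by
  rw [loopsWith, Set.mem_ofPred_eq, one_lt_degree_iff hTG hT he]
  refine and_congr_right fun h => ⟨fun hw ij => ?_, fun hw w' hw' ij => ?_⟩
  · rw [← hw w rfl ij, current₂_eq_area]
  · rw [current₂_eq_area, ← hw ij]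
    exact area_eq_of_isRotated (Quotient.exact hw').symm (h _) (h _)

end Degree

/-! ### Rotations of based loops, multiplicities and the loop measure. -/

section Counting

/-- If A and B commute and A is no longer than B, then A is a prefix of B. Removing it leaves a
shorter list that still commutes with A. -/
theorem eq_flatten_replicate_of_append_comm {α : Type*} {A : List α} (k : ℕ) :
    ∀ {B : List α}, B.length = k * A.length → A ++ B = B ++ A →
      B = (List.replicate k A).flatten := by
  induction k with
  | zero => intro B hB _; simpa using hB
  | succ k ih =>
    intro B hB hAB
    have hle : A.length ≤ B.length := by rw [hB]; nlinarith
    obtain ⟨B', rfl⟩ : A <+: B :=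
      List.prefix_of_prefix_length_le (List.prefix_append A B) (hAB ▸ List.prefix_append B A) hle
    rw [List.append_assoc, List.append_cancel_left_eq] at hAB
    rw [List.replicate_succ, List.flatten_cons, ← ih _ hAB]
    rw [List.length_append] at hB
    linarith

theorem rotate_flatten_replicate {α : Type*} (A : List α) (m : ℕ) :
    ((List.replicate m A).flatten).rotate A.length = (List.replicate m A).flatten := by
  cases m with
  | zero => simp
  | succ m =>
    rw [List.replicate_succ, List.flatten_cons, List.rotate_append_length_eq]
    rw [← List.flatten_cons, ← List.replicate_succ, List.replicate_succ', List.flatten_append]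
    simp

theorem iterate_rotate_one {α : Type*} (L : List α) (n : ℕ) :
    (fun L : List α => L.rotate 1)^[n] L = L.rotate n := by
  induction n with
  | zero => simp
  | succ n ih => rw [Function.iterate_succ_apply', ih, List.rotate_rotate]

variable {V : Type*} {G : SimpleGraph V}

/-- The least `d > 0` such that the rotation by `d` leaves the based loop unchanged. -/
def BasedLoop.period (w : BasedLoop G) : ℕ :=
  Function.minimalPeriod (fun L : List G.Dart => L.rotate 1) w.darts

theorem BasedLoop.length_darts_pos (w : BasedLoop G) : 0 < w.darts.length := by
  rw [BasedLoop.darts, SimpleGraph.Walk.length_darts]; exact w.length_pos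

theorem BasedLoop.rotate_eq_iff (w : BasedLoop G) (n : ℕ) :
    w.darts.rotate n = w.darts ↔ w.period ∣ n := by
  rw [BasedLoop.period, ← Function.isPeriodicPt_iff_minimalPeriod_dvd, Function.IsPeriodicPt,
    Function.IsFixedPt, iterate_rotate_one]

theorem BasedLoop.period_dvd (w : BasedLoop G) : w.period ∣ w.darts.length :=
  (w.rotate_eq_iff _).1 (List.rotate_length _)

theorem BasedLoop.period_pos (w : BasedLoop G) : 0 < w.period :=
  Nat.pos_of_dvd_of_pos w.period_dvd w.length_darts_pos

/-- Positive length is essential: the list determines the base point through its first edge, whereas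
trivial walks at all vertices share the empty list. -/
theorem BasedLoop.darts_injective : Function.Injective (BasedLoop.darts (G := G)) := by
  rintro ⟨x, w, hw⟩ ⟨y, w', hw'⟩ h
  cases w with
  | nil => simp at hw
  | cons a p =>
    cases w' with
    | nil => simp at hw'
    | cons b q =>
      have hxy : x = y := by
        have := congrArg (fun L : List G.Dart => L.head?.map fun d => d.fst) h
        simpa [BasedLoop.darts] using this
      subst hxy
      have hpq := SimpleGraph.Walk.darts_injective h
      simp only at hpq
      simp only [hpq]

/-- A decomposition of the list of oriented edges of a walk comes from one of the walk. -/
theorem exists_walks_of_darts_eq_append {x y : V} (w : G.Walk x y) (A : List G.Dart) (d : G.Dart)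
    (B : List G.Dart) (h : w.darts = A ++ d :: B) :
    ∃ (p : G.Walk x d.fst) (q : G.Walk d.fst y), p.darts = A ∧ q.darts = d :: B := by
  induction A generalizing x with
  | nil =>
    cases w with
    | nil => simp at h
    | cons a w =>
      simp only [SimpleGraph.Walk.darts_cons, List.nil_append, List.cons.injEq] at h
      obtain ⟨rfl, rfl⟩ := h
      exact ⟨.nil, .cons a w, rfl, rfl⟩
  | cons d' A ih =>
    cases w with
    | nil => simp at h
    | cons a w =>
      simp only [SimpleGraph.Walk.darts_cons, List.cons_append, List.cons.injEq] at h
      obtain ⟨rfl, h⟩ := h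
      obtain ⟨p, q, hp, hq⟩ := ih w h
      exact ⟨.cons a p, q, by rw [SimpleGraph.Walk.darts_cons, hp], hq⟩

theorem BasedLoop.exists_rotate (w : BasedLoop G) (n : ℕ) :
    ∃ w' : BasedLoop G, w'.darts = w.darts.rotate n := by
  rw [← List.rotate_mod]
  have hn := Nat.mod_lt n w.length_darts_pos
  set k := n % w.darts.length
  rw [List.rotate_eq_drop_append_take hn.le]
  -- The reduction modulo the length ensures that the second piece is nonempty; its first vertex is
  -- the new base point.
  obtain ⟨p, q, hp, hq⟩ := exists_walks_of_darts_eq_append w.walk (w.darts.take k) w.darts[k]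
    (w.darts.drop (k + 1)) (by
      rw [← List.drop_eq_getElem_cons hn, List.take_append_drop]; rfl)
  refine ⟨⟨_, q.append p, ?_⟩, ?_⟩
  · rw [← SimpleGraph.Walk.length_darts, SimpleGraph.Walk.darts_append, hq]
    exact List.length_pos_of_ne_nil (by
      rw [List.cons_append]; exact List.cons_ne_nil _ _)
  · change (q.append p).darts = _
    rw [SimpleGraph.Walk.darts_append, hp, hq, ← List.drop_eq_getElem_cons hn]

/-- A list fixed by rotation through its period commutes with its initial segment of that length, so
it is a power of it. Conversely, an m-th power is fixed by rotation through the length of its root,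
which the period must divide. -/
theorem BasedLoop.mult_toLoop (w : BasedLoop G) : w.toLoop.mult = w.darts.length / w.period := by
  refine IsGreatest.csSup_eq ⟨⟨w, rfl, ?_⟩, ?_⟩
  · obtain ⟨m, hm⟩ := w.period_dvd
    rw [hm, Nat.mul_div_cancel_left _ w.period_pos]
    have hlen : (w.darts.take w.period).length = w.period :=
      List.length_take_of_le (Nat.le_of_dvd w.length_darts_pos w.period_dvd)
    have hm0 : m ≠ 0 := by
      rintro rfl
      have := w.length_darts_pos
      omega
    obtain ⟨k, rfl⟩ := Nat.exists_eq_succ_of_ne_zero hm0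
    set A := w.darts.take w.period with hA
    have hcomm : A ++ w.darts.drop w.period = w.darts.drop w.period ++ A := by
      rw [hA, List.take_append_drop, ← List.rotate_eq_drop_append_take
        (Nat.le_of_dvd w.length_darts_pos w.period_dvd), (w.rotate_eq_iff _).2 dvd_rfl]
    have hB := eq_flatten_replicate_of_append_comm k (by
      rw [List.length_drop, hlen, hm, Nat.succ_eq_add_one, mul_add, mul_one,
        Nat.add_sub_cancel, mul_comm]) hcomm
    have hL : w.darts = A ++ (List.replicate k A).flatten := by
      rw [← hB, hA, List.take_append_drop]
    -- The root must be a closed walk: either it is all of `w`, or a second copy of `A` follows it,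
    -- so the first copy ends where `A` begins.
    have hq : ∃ q : G.Walk w.base w.base, q.darts = A := by
      cases k with
      | zero => exact ⟨w.walk, by rw [← BasedLoop.darts, hL]; simp⟩
      | succ k =>
        have hApos : A ≠ [] := by
          intro h0
          have := w.period_pos
          rw [h0] at hlen
          simp at hlen
          omega
        obtain ⟨d, A', hdA⟩ := List.exists_cons_of_ne_nil hApos
        obtain ⟨p, q, hp, hq⟩ := exists_walks_of_darts_eq_append w.walk A d
          (A' ++ (List.replicate k A).flatten) (by
            change w.darts = _
            rw [hL, List.replicate_succ, List.flatten_cons, ← List.cons_append, ← hdA])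
        have hbase : d.fst = w.base := by
          have h1 : w.walk.darts = d :: (A' ++ (List.replicate (k + 1) A).flatten) := by
            rw [← List.cons_append, ← hdA]; exact hL
          revert h1
          cases w.walk with
          | nil => simp
          | cons a p =>
            simp only [SimpleGraph.Walk.darts_cons, List.cons.injEq]
            rintro ⟨rfl, -⟩
            rfl
        exact ⟨p.copy rfl hbase, by rw [SimpleGraph.Walk.darts_copy, hp]⟩
    obtain ⟨q, hq⟩ := hq
    exact ⟨q, by rw [hq, List.replicate_succ, List.flatten_cons, ← hL]⟩
  · rintro m ⟨w', hw', q, hq⟩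
    obtain ⟨j, hj⟩ : w.darts ~r w'.darts := (Quotient.exact hw').symm
    have hrot : w.darts.rotate q.darts.length = w.darts := by
      apply List.rotate_injective j
      have h := rotate_flatten_replicate q.darts m
      rw [← hq, ← hj, List.rotate_rotate] at h
      change (w.darts.rotate _).rotate j = w.darts.rotate j
      rw [List.rotate_rotate, add_comm, h]
    have hdvd := (w.rotate_eq_iff _).1 hrot
    have hlen : w.darts.length = m * q.darts.length := by
      rw [← List.length_rotate (n := j), hj, hq]
      simp
    have hpos := w.length_darts_pos
    rw [hlen] at hpos
    rw [Nat.le_div_iff_mul_le w.period_pos, hlen]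
    exact Nat.mul_le_mul_left _ (Nat.le_of_dvd (Nat.pos_of_mul_pos_left hpos) hdvd)

theorem BasedLoop.nonempty_equiv_fiber (w : BasedLoop G) :
    Nonempty (Fin w.period ≃ {w' : BasedLoop G // w'.toLoop = w.toLoop}) := by
  choose rot hrot using w.exists_rotate
  let φ : Fin w.period → {w' : BasedLoop G // w'.toLoop = w.toLoop} := fun i =>
    ⟨rot i, Quotient.sound (List.IsRotated.symm ⟨i, (hrot i).symm⟩)⟩
  have hφ : Function.Bijective φ := by
    constructor
    · intro i j hij
      have h : w.darts.rotate i = w.darts.rotate j := by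
        rw [← hrot, ← hrot]
        exact congrArg (fun z => BasedLoop.darts z.1) hij
      rw [← iterate_rotate_one, ← iterate_rotate_one] at h
      exact Fin.ext (Function.iterate_injOn_Iio_minimalPeriod i.2 j.2 h)
    · rintro ⟨w', hw'⟩
      obtain ⟨j, hj⟩ : w.darts ~r w'.darts := (Quotient.exact hw').symm
      refine ⟨⟨j % w.period, Nat.mod_lt _ w.period_pos⟩, Subtype.ext ?_⟩
      apply BasedLoop.darts_injective
      change (rot (j % w.period)).darts = _
      rw [hrot, ← hj, ← iterate_rotate_one, ← iterate_rotate_one]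
      exact Function.iterate_mod_minimalPeriod_eq
  exact ⟨Equiv.ofBijective φ hφ⟩

theorem Weights.cond_nonneg (W : Weights G) (x y : V) : 0 ≤ W.cond x y := by
  by_cases h : G.Adj x y
  · exact (W.cond_pos x y h).le
  · exact (W.cond_zero x y h).ge

variable [Fintype V] (W : Weights G)

theorem Weights.duality_nonneg (x : V) : 0 ≤ W.duality x :=
  add_nonneg (W.kill_nonneg x) (Finset.sum_nonneg fun y _ => W.cond_nonneg x y)

theorem Weights.transition_nonneg (x y : V) : 0 ≤ W.transition x y :=
  div_nonneg (W.cond_nonneg x y) (W.duality_nonneg x)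

/-- The product of the transition probabilities along a list of oriented edges. -/
def Weights.dartProd (L : List G.Dart) : ℝ := (L.map fun d => W.transition d.fst d.snd).prod

theorem Weights.dartProd_nonneg (L : List G.Dart) : 0 ≤ W.dartProd L := by
  refine List.prod_nonneg fun x hx => ?_
  obtain ⟨d, -, rfl⟩ := List.mem_map.1 hx
  exact W.transition_nonneg _ _

/-- The weight of a based loop: the product of the transition probabilities, divided by the
length. -/
def BasedLoop.weight (w : BasedLoop G) : ℝ := W.dartProd w.darts / w.darts.length

theorem BasedLoop.weight_nonneg (w : BasedLoop G) : 0 ≤ w.weight W :=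
  div_nonneg (W.dartProd_nonneg _) (Nat.cast_nonneg _)

/-- There are `period` representatives, each of weight product/length, and period/length is 1/mult.
-/
theorem tsum_fiber_weight (l : Loop G) :
    ∑' w : (BasedLoop.toLoop (G := G)) ⁻¹' {l}, ENNReal.ofReal (w.1.weight W) = l.weight W := by
  obtain ⟨w, rfl⟩ : ∃ w : BasedLoop G, w.toLoop = l := Quotient.exists_rep l
  obtain ⟨φ⟩ := w.nonempty_equiv_fiber
  have hconst : ∀ w' : (BasedLoop.toLoop (G := G)) ⁻¹' {w.toLoop},
      ENNReal.ofReal (w'.1.weight W) = ENNReal.ofReal (w.weight W) := by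
    rintro ⟨w', hw'⟩
    have h : w'.darts ~r w.darts := Quotient.exact hw'
    rw [BasedLoop.weight, BasedLoop.weight, h.perm.length_eq, Weights.dartProd, Weights.dartProd,
      (h.perm.map _).prod_eq]
  rw [tsum_congr hconst]
  refine (φ.tsum_eq (fun _ => ENNReal.ofReal (w.weight W))).symm.trans ?_
  rw [tsum_fintype, Finset.sum_const, Finset.card_univ, Fintype.card_fin, Loop.weight,
    BasedLoop.mult_toLoop]
  change _ = ENNReal.ofReal (1 / _ * W.dartProd w.darts)
  rw [← ENNReal.ofReal_nsmul, BasedLoop.weight]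
  congr 1
  obtain ⟨m, hm⟩ := w.period_dvd
  have h1 : (w.period : ℝ) ≠ 0 := by exact_mod_cast w.period_pos.ne'
  rw [hm, Nat.mul_div_cancel_left _ w.period_pos, nsmul_eq_mul]
  push_cast
  field_simp

theorem loopMeasure_apply_eq_tsum_loop (A : Set (Loop G)) :
    loopMeasure W A = ∑' l : Loop G, A.indicator (fun l => (l.weight W : ℝ≥0∞)) l := by
  rw [loopMeasure, Measure.sum_apply _ (MeasurableSpace.measurableSet_top)]
  refine tsum_congr fun l => ?_
  rw [Measure.smul_apply, Measure.dirac_apply' _ (MeasurableSpace.measurableSet_top)]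
  by_cases h : l ∈ A <;> simp [h]

theorem loopMeasure_apply_eq_tsum (A : Set (Loop G)) :
    loopMeasure W A = ∑' w : BasedLoop G,
      ((BasedLoop.toLoop (G := G)) ⁻¹' A).indicator (fun w => ENNReal.ofReal (w.weight W)) w := by
  rw [loopMeasure_apply_eq_tsum_loop, ← ENNReal.tsum_fiberwise _ (BasedLoop.toLoop (G := G))]
  refine tsum_congr fun l => ?_
  by_cases hl : l ∈ A
  · rw [Set.indicator_of_mem hl, ← tsum_fiber_weight]
    refine tsum_congr fun w => ?_
    rw [Set.indicator_of_mem]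
    have hw : w.1.toLoop = l := w.2
    simpa [hw] using hl
  · rw [Set.indicator_of_notMem hl]
    symm
    rw [ENNReal.tsum_eq_zero]
    intro w
    rw [Set.indicator_of_notMem]
    have hw : w.1.toLoop = l := w.2
    simpa [hw] using hl

instance : Countable (BasedLoop G) :=
  have : Countable G.Dart := (SimpleGraph.Dart.toProd_injective (G := G)).countable
  BasedLoop.darts_injective.countable

instance : Countable (Loop G) := inferInstanceAs (Countable (Quotient _))

end Counting

/-! ### The logarithm of the determinant of a Hermitian perturbation of the identity. -/

section LogDet

variable {ι : Type*} [Fintype ι] [DecidableEq ι] {A : Matrix ι ι ℂ}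

theorem trace_pow_eq_sum_eigenvalues (hA : A.IsHermitian) (n : ℕ) :
    (A ^ n).trace = ((∑ i, hA.eigenvalues i ^ n : ℝ) : ℂ) := by
  conv_lhs => rw [hA.spectral_theorem, ← map_pow, Unitary.conjStarAlgAut_apply,
    Matrix.trace_mul_comm, ← mul_assoc, Unitary.coe_star_mul_self, one_mul, Matrix.diagonal_pow,
    Matrix.trace_diagonal]
  simp

theorem det_one_sub_eq_prod_eigenvalues (hA : A.IsHermitian) :
    (1 - A).det = ((∏ i, (1 - hA.eigenvalues i) : ℝ) : ℂ) := by
  have h := Matrix.eval_charpoly A 1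
  rw [hA.charpoly_eq, map_one] at h
  rw [← h, Polynomial.eval_prod]
  simp

/-- If `∑ tr Aⁿ` converges, then `log det (I - A) = - ∑ tr Aⁿ / n`, for Hermitian `A`. -/
theorem hasSum_trace_pow_div (hA : A.IsHermitian)
    (h : Tendsto (fun n => (A ^ n).trace) atTop (𝓝 0)) :
    HasSum (fun n : ℕ => (A ^ (n + 1)).trace / (n + 1)) (-Complex.log (1 - A).det) := by
  have habs : ∀ i, |hA.eigenvalues i| < 1 := by
    intro i
    -- In even powers all terms are nonnegative, so each eigenvalue is controlled by the trace.
    have h2 : Tendsto (fun n => ∑ j, hA.eigenvalues j ^ (2 * n)) atTop (𝓝 0) := by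
      have h3 : Tendsto (fun n => ((A ^ (2 * n)).trace).re) atTop (𝓝 (0 : ℂ).re) :=
        (Complex.continuous_re.tendsto 0).comp
          (h.comp (tendsto_id.const_mul_atTop' (by norm_num : 0 < 2)))
      simpa only [trace_pow_eq_sum_eigenvalues hA, Complex.ofReal_re, Complex.zero_re] using h3
    have h4 : Tendsto (fun n => (hA.eigenvalues i ^ 2) ^ n) atTop (𝓝 0) := by
      refine squeeze_zero (fun n => by positivity) (fun n => ?_) h2
      rw [← pow_mul]
      exact Finset.single_le_sum (f := fun j => hA.eigenvalues j ^ (2 * n))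
        (fun j _ => (even_two_mul n).pow_nonneg _) (Finset.mem_univ i)
    rw [tendsto_pow_atTop_nhds_zero_iff, abs_pow] at h4
    exact (sq_lt_one_iff₀ (abs_nonneg _)).1 h4
  have hpos : ∀ i, 0 < 1 - hA.eigenvalues i := fun i => by
    have := (abs_lt.1 (habs i)).2; linarith
  have hsum := hasSum_sum (s := Finset.univ) fun i (_ : i ∈ Finset.univ) =>
    Real.hasSum_pow_div_log_of_abs_lt_one (habs i)
  -- All factors 1 - λ_i are positive, so the principal complex logarithm is the real one and no
  -- branch question arises.
  rw [det_one_sub_eq_prod_eigenvalues hA, ← Complex.ofReal_log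
    (Finset.prod_nonneg fun i _ => (hpos i).le), Real.log_prod fun i _ => (hpos i).ne']
  convert Complex.hasSum_ofReal.2 hsum using 1
  · ext n
    rw [trace_pow_eq_sum_eigenvalues hA, ← Finset.sum_div]
    push_cast
    rfl
  · push_cast; simp

end LogDet

/-! ### Powers of block matrices as sums over walks. -/

section Walks

variable {V : Type*} [Fintype V] [DecidableEq V] {G : SimpleGraph V} [DecidableRel G.Adj]

/-- Decomposition according to the first step. -/
theorem sum_finsetWalkLength_succ {M : Type*} [AddCommMonoid M] (n : ℕ) {x y : V}
    (f : G.Walk x y → M) :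
    ∑ w ∈ G.finsetWalkLength (n + 1) x y, f w =
      ∑ z, if h : G.Adj x z then ∑ w ∈ G.finsetWalkLength n z y, f (.cons h w) else 0 := by
  rw [SimpleGraph.finsetWalkLength, Finset.sum_biUnion]
  · refine Finset.sum_of_injOn Subtype.val Subtype.val_injective.injOn
      (fun _ _ => Finset.mem_coe.2 (Finset.mem_univ _)) ?_ ?_
    · intro z _ hz
      exact dif_neg fun h : G.Adj x z => hz ⟨⟨z, h⟩, Finset.mem_coe.2 (Finset.mem_univ _), rfl⟩
    · rintro ⟨z, hz⟩ _
      exact (Finset.sum_map _ _ _).trans (dif_pos (c := G.Adj x z)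
        (t := fun h => ∑ w ∈ G.finsetWalkLength n z y, f (.cons h w)) hz).symm
  · intro z _ z' _ hzz'
    rw [Function.onFun, Finset.disjoint_left]
    rintro w hw hw'
    obtain ⟨p, -, rfl⟩ := Finset.mem_map.1 hw
    obtain ⟨p', -, h⟩ := Finset.mem_map.1 hw'
    have h1 := (SimpleGraph.Walk.cons.injEq .. ▸ h).1
    exact hzz' (Subtype.ext h1.symm)

/-- The powers of a matrix with blocks `P^x_y B(x,y)`, as sums over the walks. -/
theorem block_pow_apply {𝕜 S : Type*} [CommSemiring 𝕜] [Fintype S] [DecidableEq S]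
    (P : V → V → 𝕜) (hP : ∀ x y, ¬ G.Adj x y → P x y = 0) (B : V → V → Matrix S S 𝕜)
    (n : ℕ) (s t : V × S) :
    ((Matrix.of fun s t : V × S => P s.1 t.1 * B s.1 t.1 s.2 t.2) ^ n) s t =
      ∑ w ∈ G.finsetWalkLength n s.1 t.1, (w.darts.map fun d => P d.fst d.snd).prod *
        (w.darts.map fun d => B d.fst d.snd).prod s.2 t.2 := by
  induction n generalizing s with
  | zero =>
    obtain ⟨x, i⟩ := s
    obtain ⟨y, j⟩ := t
    by_cases h : x = y
    · subst h
      simp [SimpleGraph.finsetWalkLength, Matrix.one_apply]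
    · simp [SimpleGraph.finsetWalkLength, h]
  | succ n ih =>
    rw [pow_succ', Matrix.mul_apply, Fintype.sum_prod_type, sum_finsetWalkLength_succ]
    refine Finset.sum_congr rfl fun z _ => ?_
    by_cases h : G.Adj s.1 z
    · simp only [dif_pos h, SimpleGraph.Walk.darts_cons, List.map_cons, List.prod_cons, ih,
        Matrix.mul_apply, Matrix.of_apply, Finset.mul_sum]
      rw [Finset.sum_comm]
      refine Finset.sum_congr rfl fun w _ => Finset.sum_congr rfl fun k _ => ?_
      ring
    · rw [dif_neg h]
      exact Finset.sum_eq_zero fun k _ => by simp [hP _ _ h]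

theorem pow_apply_eq_sum_walks {𝕜 : Type*} [CommSemiring 𝕜] (P : V → V → 𝕜)
    (hP : ∀ x y, ¬ G.Adj x y → P x y = 0) (n : ℕ) (x y : V) :
    ((Matrix.of P) ^ n) x y =
      ∑ w ∈ G.finsetWalkLength n x y, (w.darts.map fun d => P d.fst d.snd).prod := by
  induction n generalizing x with
  | zero =>
    by_cases h : x = y
    · subst h
      simp [SimpleGraph.finsetWalkLength]
    · simp [SimpleGraph.finsetWalkLength, h]
  | succ n ih =>
    rw [pow_succ', Matrix.mul_apply, sum_finsetWalkLength_succ]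
    refine Finset.sum_congr rfl fun z _ => ?_
    by_cases h : G.Adj x z
    · simp only [dif_pos h, SimpleGraph.Walk.darts_cons, List.map_cons, List.prod_cons, ih,
        Matrix.of_apply, Finset.mul_sum]
    · simp [dif_neg h, hP _ _ h]

/-- Based loops, sorted by their lengths and their base points. -/
def basedLoopEquiv (G : SimpleGraph V) [DecidableRel G.Adj] :
    (Σ n : ℕ, Σ x : V, {w : G.Walk x x // w ∈ G.finsetWalkLength (n + 1) x x}) ≃ BasedLoop G where
  toFun z := ⟨z.2.1, z.2.2.1, by
    rw [(SimpleGraph.mem_finsetWalkLength_iff).1 z.2.2.2]; exact Nat.succ_pos _⟩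
  invFun w := ⟨w.walk.length - 1, w.base, w.walk, by
    rw [SimpleGraph.mem_finsetWalkLength_iff, Nat.sub_add_cancel w.length_pos]⟩
  left_inv := by
    rintro ⟨n, x, w, hw⟩
    have h : w.length = n + 1 := (SimpleGraph.mem_finsetWalkLength_iff).1 hw
    obtain rfl : n = w.length - 1 := by omega
    rfl
  right_inv _ := rfl

end Walks

/-! ### Decay of the killed Markov chain and summability of the based-loop weights. -/

section Transition

variable {V : Type*} [Fintype V] {G : SimpleGraph V} (W : Weights G)

theorem Weights.transition_eq_zero {x y : V} (h : ¬ G.Adj x y) : W.transition x y = 0 := by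
  rw [Weights.transition, W.cond_zero x y h, zero_div]

/-- A vertex different from the killing vertex `k` has a neighbour, the next vertex on a walk to
`k`. -/
theorem Weights.duality_pos (hG : G.Connected) (x : V) : 0 < W.duality x := by
  obtain ⟨k, hk⟩ := W.kill_ne_zero
  have hsum := Finset.sum_nonneg fun y (_ : y ∈ Finset.univ) => W.cond_nonneg x y
  by_cases hx : x = k
  · subst hx
    exact add_pos_of_pos_of_nonneg (lt_of_le_of_ne (W.kill_nonneg _) hk.symm) hsum
  · obtain ⟨w⟩ := hG.preconnected x k
    cases w with
    | nil => exact absurd rfl hx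
    | cons h w =>
      exact add_pos_of_nonneg_of_pos (W.kill_nonneg _)
        (Finset.sum_pos' (fun y _ => W.cond_nonneg x y) ⟨_, Finset.mem_univ _, W.cond_pos _ _ h⟩)

theorem Weights.sum_transition (x : V) (h : 0 < W.duality x) :
    ∑ y, W.transition x y = 1 - W.kill x / W.duality x := by
  simp only [Weights.transition]
  rw [← Finset.sum_div, eq_sub_iff_add_eq, ← add_div, add_comm, ← Weights.duality, div_self h.ne']

/-- The probability that the Markov chain started at `x` makes `n` steps before being killed. -/
def Weights.survival : ℕ → V → ℝ
  | 0, _ => 1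
  | n + 1, x => ∑ z, W.transition x z * Weights.survival n z

theorem Weights.survival_nonneg (n : ℕ) (x : V) : 0 ≤ W.survival n x := by
  induction n generalizing x with
  | zero => exact zero_le_one
  | succ n ih => exact Finset.sum_nonneg fun z _ => mul_nonneg (W.transition_nonneg _ _) (ih z)

theorem Weights.survival_succ_le (hG : G.Connected) (n : ℕ) (x : V) :
    W.survival (n + 1) x ≤ W.survival n x := by
  induction n generalizing x with
  | zero =>
    have := div_nonneg (W.kill_nonneg x) (W.duality_nonneg x)
    simp only [Weights.survival, mul_one]
    rw [W.sum_transition x (W.duality_pos hG x)]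
    linarith
  | succ n ih =>
    exact Finset.sum_le_sum fun z _ => mul_le_mul_of_nonneg_left (ih z) (W.transition_nonneg _ _)

theorem Weights.survival_antitone (hG : G.Connected) (x : V) :
    Antitone fun n => W.survival n x :=
  antitone_nat_of_succ_le fun n => W.survival_succ_le hG n x

/-- Following `w` has positive probability, and the chain may then be killed at `k`; this last event
accounts for the extra step. -/
theorem Weights.survival_lt_one (hG : G.Connected) {x k : V} (hk : W.kill k ≠ 0)
    (w : G.Walk x k) : W.survival (w.length + 1) x < 1 := by
  induction w with
  | nil =>
    rename_i k
    have := div_pos (lt_of_le_of_ne (W.kill_nonneg k) hk.symm) (W.duality_pos hG k)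
    simp only [SimpleGraph.Walk.length_nil, Weights.survival, mul_one]
    rw [W.sum_transition k (W.duality_pos hG k)]
    linarith
  | @cons x z k h w ih =>
    have h1 : W.survival 1 x ≤ 1 := W.survival_succ_le hG 0 x
    refine lt_of_lt_of_le ?_ h1
    rw [SimpleGraph.Walk.length_cons, Weights.survival, Weights.survival]
    refine Finset.sum_lt_sum (fun y _ => mul_le_mul_of_nonneg_left
      (W.survival_antitone hG y (Nat.zero_le _)) (W.transition_nonneg _ _))
      ⟨z, Finset.mem_univ _, mul_lt_mul_of_pos_left (ih hk) ?_⟩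
    exact div_pos (W.cond_pos _ _ h) (W.duality_pos hG _)

theorem Weights.survival_add_le {N : ℕ} {ρ : ℝ} (h : ∀ x, W.survival N x ≤ ρ) (m : ℕ) (x : V) :
    W.survival (m + N) x ≤ ρ * W.survival m x := by
  induction m generalizing x with
  | zero => simpa [Weights.survival] using h x
  | succ m ih =>
    rw [Nat.add_right_comm, Weights.survival, Weights.survival, Finset.mul_sum]
    refine Finset.sum_le_sum fun z _ => ?_
    rw [mul_left_comm]
    exact mul_le_mul_of_nonneg_left (ih z) (W.transition_nonneg _ _)

theorem Weights.summable_survival (hG : G.Connected) (x : V) :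
    Summable fun n => W.survival n x := by
  obtain ⟨k, hk⟩ := W.kill_ne_zero
  obtain ⟨N, hN⟩ : ∃ N, ∀ x, W.survival N x < 1 := by
    let w : ∀ x, G.Walk x k := fun x => (hG.preconnected x k).some
    -- The sum over all starting points is merely a common upper bound, usable because survival
    -- decreases in time.
    refine ⟨∑ y, ((w y).length + 1), fun x => ?_⟩
    refine lt_of_le_of_lt (W.survival_antitone hG x ?_) (W.survival_lt_one hG hk (w x))
    exact Finset.single_le_sum (f := fun y => (w y).length + 1) (fun _ _ => Nat.zero_le _)
      (Finset.mem_univ x)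
  obtain ⟨ρ, hρ1, hρ⟩ : ∃ ρ < 1, ∀ x, W.survival N x ≤ ρ := by
    have : Nonempty V := hG.nonempty
    obtain ⟨y, hy⟩ := Finite.exists_max fun x => W.survival N x
    exact ⟨_, hN y, hy⟩
  -- A partial sum S satisfies S ≤ (sum of the first N terms) + ρ S, whence this bound.
  refine summable_of_sum_range_le (c := (∑ n ∈ Finset.range N, W.survival n x) / (1 - ρ))
    (fun n => W.survival_nonneg n x) fun K => ?_
  rw [le_div_iff₀ (by linarith)]
  have h1 : ∑ n ∈ Finset.range K, W.survival n x ≤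
      ∑ n ∈ Finset.range (N + K), W.survival n x :=
    Finset.sum_le_sum_of_subset_of_nonneg (Finset.range_mono (Nat.le_add_left _ _))
      fun n _ _ => W.survival_nonneg n x
  have h2 : ∑ n ∈ Finset.range K, W.survival (N + n) x ≤
      ρ * ∑ n ∈ Finset.range K, W.survival n x := by
    rw [Finset.mul_sum]
    refine Finset.sum_le_sum fun n _ => ?_
    rw [add_comm]
    exact W.survival_add_le hρ n x
  rw [Finset.sum_range_add] at h1
  linarith

variable [DecidableEq V]

theorem Weights.sum_pow_transition (n : ℕ) (x : V) :
    ∑ y, ((Matrix.of W.transition) ^ n) x y = W.survival n x := by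
  induction n generalizing x with
  | zero => simp [Weights.survival, Matrix.one_apply]
  | succ n ih =>
    simp only [pow_succ', Matrix.mul_apply, Weights.survival, ← ih, Finset.mul_sum]
    rw [Finset.sum_comm]
    rfl

variable [DecidableRel G.Adj]

theorem Weights.sum_dartProd_le (n : ℕ) (x : V) :
    ∑ w ∈ G.finsetWalkLength n x x, W.dartProd w.darts ≤ W.survival n x := by
  have hP : ∀ x y, ¬ G.Adj x y → W.transition x y = 0 := fun x y => W.transition_eq_zero
  rw [← W.sum_pow_transition]
  simp only [pow_apply_eq_sum_walks W.transition hP]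
  exact Finset.single_le_sum (f := fun y => ∑ w ∈ G.finsetWalkLength n x y, W.dartProd w.darts)
    (fun y _ => Finset.sum_nonneg fun w _ => W.dartProd_nonneg w.darts) (Finset.mem_univ x)

theorem basedLoopEquiv_darts (z : Σ n : ℕ, Σ x : V, {w : G.Walk x x //
    w ∈ G.finsetWalkLength (n + 1) x x}) : (basedLoopEquiv G z).darts = z.2.2.1.darts := rfl

theorem basedLoopEquiv_weight (z : Σ n : ℕ, Σ x : V, {w : G.Walk x x //
    w ∈ G.finsetWalkLength (n + 1) x x}) :
    (basedLoopEquiv G z).weight W = W.dartProd z.2.2.1.darts / (z.1 + 1 : ℝ) := by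
  rw [BasedLoop.weight, basedLoopEquiv_darts, SimpleGraph.Walk.length_darts,
    SimpleGraph.mem_finsetWalkLength_iff.1 z.2.2.2]
  push_cast
  rfl

/-- This summable family dominates every later series over based loops, uniformly in `p` and `u`. -/
theorem summable_weight (hG : G.Connected) :
    Summable fun w : BasedLoop G => w.weight W := by
  rw [← (basedLoopEquiv G).summable_iff, Function.comp_def]
  simp only [basedLoopEquiv_weight]
  rw [summable_sigma_of_nonneg fun z => div_nonneg (W.dartProd_nonneg _) (by positivity)]
  refine ⟨fun n => (hasSum_fintype _).summable, ?_⟩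
  have hs : Summable fun n => ∑ x, W.survival (n + 1) x :=
    summable_sum fun x _ => (summable_nat_add_iff (f := fun n => W.survival n x) 1).2 (W.summable_survival hG x)
  refine Summable.of_nonneg_of_le
    (fun n => tsum_nonneg fun z => div_nonneg (W.dartProd_nonneg _) (by positivity))
    (fun n => ?_) hs
  rw [tsum_fintype, Fintype.sum_sigma]
  refine Finset.sum_le_sum fun x _ => ?_
  rw [Finset.sum_coe_sort (G.finsetWalkLength (n + 1) x x)
    (fun w => W.dartProd w.darts / (n + 1 : ℝ))]
  refine le_trans (Finset.sum_le_sum fun w _ => ?_) (W.sum_dartProd_le (n + 1) x)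
  exact div_le_self (W.dartProd_nonneg _) (by simp)

end Transition

/-! ### Traces and unitarity of the representation `U_h`. -/

section Schrodinger

variable {r p : ℕ} [NeZero p]

theorem toMatrix_schrodinger_apply (h : Matrix (Fin r) (Fin r) (ZMod p)) (g : NilGroup r p)
    (s t : Fin r → ZMod p) : LinearMap.toMatrix' (schrodinger h g) s t =
      ZMod.stdAddChar (∑ i, ∑ j, h i j * g.c i j + ∑ i, g.a i * s i) *
        if s - h.mulVec g.a = t then 1 else 0 := by
  rw [LinearMap.toMatrix'_apply]
  change ZMod.stdAddChar _ * (Pi.single t (1 : ℂ) : (Fin r → ZMod p) → ℂ) _ = _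
  rw [Pi.single_apply]

/-- Translation by a basis vector on which the character is nontrivial multiplies the sum by a
number other than 1. -/
theorem sum_stdAddChar_dot_eq_zero {a : Fin r → ZMod p} (ha : a ≠ 0) :
    ∑ x : Fin r → ZMod p, ZMod.stdAddChar (∑ i, a i * x i) = 0 := by
  obtain ⟨i, hi⟩ := Function.ne_iff.1 ha
  have hshift : ∑ x : Fin r → ZMod p, ZMod.stdAddChar (∑ j, a j * x j) =
      ZMod.stdAddChar (a i) * ∑ x : Fin r → ZMod p, ZMod.stdAddChar (∑ j, a j * x j) := by
    rw [Finset.mul_sum]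
    conv_lhs => rw [← Equiv.sum_comp (Equiv.addRight (Pi.single i (1 : ZMod p)))]
    refine Finset.sum_congr rfl fun x _ => ?_
    rw [← AddChar.map_add_eq_mul]
    refine congrArg _ ?_
    have hs : ∑ j, a j * (Pi.single i (1 : ZMod p) : Fin r → ZMod p) j = a i := by
      simp [Pi.single_apply]
    rw [← hs, ← Finset.sum_add_distrib]
    refine Finset.sum_congr rfl fun j _ => ?_
    change a j * (x j + (Pi.single i (1 : ZMod p) : Fin r → ZMod p) j) = _
    ring
  have hne : (ZMod.stdAddChar (a i) : ℂ) ≠ 1 := by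
    rw [← AddChar.map_zero_eq_one (ZMod.stdAddChar (N := p))]
    exact fun h => hi (ZMod.injective_stdAddChar h)
  by_contra h0
  exact hne (mul_right_cancel₀ h0 (by rw [← hshift, one_mul]))

/-- Whether a diagonal entry survives depends on h·a = 0 and not on the point, so a full character
sum factors out. -/
theorem trace_schrodinger_of_ne_zero (h : Matrix (Fin r) (Fin r) (ZMod p)) {g : NilGroup r p}
    (hg : g.a ≠ 0) : (LinearMap.toMatrix' (schrodinger h g)).trace = 0 := by
  simp only [Matrix.trace, Matrix.diag_apply, toMatrix_schrodinger_apply, sub_eq_self]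
  rw [← Finset.sum_mul]
  simp only [AddChar.map_add_eq_mul]
  rw [← Finset.mul_sum, sum_stdAddChar_dot_eq_zero hg]
  simp

theorem trace_schrodinger_of_eq_zero (h : Matrix (Fin r) (Fin r) (ZMod p)) {g : NilGroup r p}
    (hg : g.a = 0) : (LinearMap.toMatrix' (schrodinger h g)).trace =
      (p : ℂ) ^ r * ZMod.stdAddChar (∑ i, ∑ j, h i j * g.c i j) := by
  simp only [Matrix.trace, Matrix.diag_apply, toMatrix_schrodinger_apply, hg]
  simp [ZMod.card]

theorem norm_trace_schrodinger_le (h : Matrix (Fin r) (Fin r) (ZMod p)) (g : NilGroup r p) :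
    ‖(LinearMap.toMatrix' (schrodinger h g)).trace‖ ≤ (p : ℝ) ^ r := by
  by_cases hg : g.a = 0
  · rw [trace_schrodinger_of_eq_zero h hg, norm_mul, AddChar.norm_apply]
    simp
  · rw [trace_schrodinger_of_ne_zero h hg, norm_zero]
    positivity

theorem schrodinger_one (h : Matrix (Fin r) (Fin r) (ZMod p)) :
    schrodinger h (1 : NilGroup r p) = LinearMap.id := by
  ext1 ψ
  ext x
  simp [schrodinger, NilGroup.one_a, NilGroup.one_c]

theorem two_ne_zero_of_odd_prime {p : ℕ} [Fact p.Prime] (hp : p ≠ 2) : (2 : ZMod p) ≠ 0 := by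
  intro h0
  have h1 : ((2 : ℕ) : ZMod p) = 0 := by exact_mod_cast h0
  rw [ZMod.natCast_eq_zero_iff] at h1
  exact hp ((Nat.prime_dvd_prime_iff_eq Fact.out Nat.prime_two).1 h1)

theorem sum_mul_mulVec_eq_zero {p : ℕ} [Fact p.Prime] (hp : p ≠ 2)
    {h : Matrix (Fin r) (Fin r) (ZMod p)} (hh : h.transpose = -h) (a : Fin r → ZMod p) :
    ∑ i, a i * h.mulVec a i = 0 := by
  have h1 : a ⬝ᵥ h.mulVec a = - (a ⬝ᵥ h.mulVec a) := by
    conv_lhs => rw [Matrix.dotProduct_mulVec, ← Matrix.mulVec_transpose, hh, Matrix.neg_mulVec,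
      neg_dotProduct, dotProduct_comm]
  have h2 : (2 : ZMod p) * (a ⬝ᵥ h.mulVec a) = 0 := by linear_combination h1
  exact (mul_eq_zero.1 h2).resolve_left (two_ne_zero_of_odd_prime hp)

/-- The representation `U_h` is unitary. -/
theorem conjTranspose_toMatrix_schrodinger {p : ℕ} [NeZero p] [Fact p.Prime] (hp : p ≠ 2)
    {h : Matrix (Fin r) (Fin r) (ZMod p)} (hh : h.transpose = -h) (g : NilGroup r p) :
    (LinearMap.toMatrix' (schrodinger h g)).conjTranspose =
      LinearMap.toMatrix' (schrodinger h g⁻¹) := by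
  ext s t
  rw [Matrix.conjTranspose_apply, toMatrix_schrodinger_apply, toMatrix_schrodinger_apply,
    NilGroup.inv_a, NilGroup.inv_c, Matrix.mulVec_neg]
  by_cases hst : t - h.mulVec g.a = s
  · have hts : s - -h.mulVec g.a = t := by rw [← hst]; abel
    rw [if_pos hst, if_pos hts, mul_one, mul_one, ← starRingEnd_apply, ← AddChar.map_neg_eq_conj]
    congr 1
    -- The phases at `t` and at the translated point differ by ⟨a, h·a⟩, which is zero since `h` is
    -- alternating.
    have h0 := sum_mul_mulVec_eq_zero hp hh g.a
    rw [← hst]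
    simp only [Pi.sub_apply, Pi.neg_apply, Matrix.neg_apply, mul_neg, neg_mul, mul_sub,
      Finset.sum_neg_distrib, Finset.sum_sub_distrib, h0]
    ring
  · have hts : ¬ s - -h.mulVec g.a = t := fun h' => hst (by rw [← h']; abel)
    rw [if_neg hst, if_neg hts]
    simp

end Schrodinger

/-! ### The logarithm of the determinant as a sum over based loops. -/

section LogDetExpansion

variable {V : Type*} [DecidableEq V] {G : SimpleGraph V} {r p : ℕ}

theorem connection_symm (e : Fin r → G.Dart) (x y : V) :
    connection p e y x = (connection p e x y)⁻¹ := by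
  ext i j
  · simp only [NilGroup.inv_a, connection, Pi.neg_apply]; ring
  · simp [NilGroup.inv_c, connection]

variable [NeZero p]

/-- The conjugate of `P^{(A,h)}` by the square root of the duality measure. -/
def symmetrization [Fintype V] (W : Weights G) (e : Fin r → G.Dart) (h : Matrix (Fin r) (Fin r) (ZMod p)) :
    Matrix (V × (Fin r → ZMod p)) (V × (Fin r → ZMod p)) ℂ :=
  Matrix.diagonal (fun s => (Real.sqrt (W.duality s.1) : ℂ)) * extendedTransition W e h *
    Matrix.diagonal (fun s => (Real.sqrt (W.duality s.1) : ℂ)⁻¹)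

theorem exists_units_conj_symmetrization [Fintype V] (hG : G.Connected) (W : Weights G) (e : Fin r → G.Dart)
    (h : Matrix (Fin r) (Fin r) (ZMod p)) :
    ∃ D : (Matrix (V × (Fin r → ZMod p)) (V × (Fin r → ZMod p)) ℂ)ˣ,
      symmetrization W e h = D.val * extendedTransition W e h * D⁻¹.val := by
  have h1 : ∀ x, (Real.sqrt (W.duality x) : ℂ) ≠ 0 := fun x => by
    exact_mod_cast (Real.sqrt_pos.2 (W.duality_pos hG x)).ne'
  exact ⟨⟨_, _, (Matrix.diagonal_mul_diagonal _ _).trans (by simp [h1]),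
    (Matrix.diagonal_mul_diagonal _ _).trans (by simp [h1])⟩, rfl⟩

variable [Fact p.Prime]

theorem prod_toMatrix_schrodinger (hp : p ≠ 2) {h : Matrix (Fin r) (Fin r) (ZMod p)}
    (hh : h.transpose = -h) (e : Fin r → G.Dart) (L : List G.Dart) :
    (L.map fun d => LinearMap.toMatrix' (schrodinger h (connection p e d.fst d.snd))).prod =
      LinearMap.toMatrix' (schrodinger h (holonomy p e L)) := by
  induction L with
  | nil => simp [holonomy, schrodinger_one]
  | cons d L ih =>
    rw [List.map_cons, List.prod_cons, ih, ← LinearMap.toMatrix'_comp, ← schrodinger_mul hp hh]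
    rfl

variable [Fintype V]

theorem trace_extendedTransition_pow [DecidableRel G.Adj] (W : Weights G) (hp : p ≠ 2)
    {h : Matrix (Fin r) (Fin r) (ZMod p)} (hh : h.transpose = -h) (e : Fin r → G.Dart) (n : ℕ) :
    (extendedTransition W e h ^ n).trace = ∑ x, ∑ w ∈ G.finsetWalkLength n x x,
      (W.dartProd w.darts : ℂ) *
        (LinearMap.toMatrix' (schrodinger h (holonomy p e w.darts))).trace := by
  have hP : ∀ x y, ¬ G.Adj x y → (W.transition x y : ℂ) = 0 := fun x y hxy => by
    rw [W.transition_eq_zero hxy, Complex.ofReal_zero]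
  have hM : extendedTransition W e h = Matrix.of fun s t : V × (Fin r → ZMod p) =>
    (W.transition s.1 t.1 : ℂ) *
      LinearMap.toMatrix' (schrodinger h (connection p e s.1 t.1)) s.2 t.2 := rfl
  have hblock := block_pow_apply (fun x y => (W.transition x y : ℂ)) hP
    (fun x y => LinearMap.toMatrix' (schrodinger h (connection p e x y))) n
  simp only [Matrix.trace, Matrix.diag_apply, Fintype.sum_prod_type, hM]
  refine Finset.sum_congr rfl fun x _ => ?_
  simp only [hblock, prod_toMatrix_schrodinger hp hh, Finset.mul_sum]
  rw [Finset.sum_comm]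
  refine Finset.sum_congr rfl fun w _ => Finset.sum_congr rfl fun i _ => ?_
  congr 1
  rw [Weights.dartProd, ← Complex.ofRealHom_eq_coe, map_list_prod, List.map_map]
  rfl

/-- The block at (x, y) becomes C_{x,y}/√(λ_x λ_y) times a unitary matrix, and exchanging x and y
inverts that matrix. -/
theorem isHermitian_symmetrization (hG : G.Connected) (W : Weights G) (hp : p ≠ 2)
    {h : Matrix (Fin r) (Fin r) (ZMod p)} (hh : h.transpose = -h) (e : Fin r → G.Dart) :
    (symmetrization W e h).IsHermitian := by
  ext s t
  rw [Matrix.conjTranspose_apply, symmetrization, Matrix.mul_diagonal, Matrix.diagonal_mul,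
    Matrix.mul_diagonal, Matrix.diagonal_mul, extendedTransition, extendedTransition,
    connection_symm e s.1 t.1, ← conjTranspose_toMatrix_schrodinger hp hh,
    Matrix.conjTranspose_apply]
  simp only [star_mul', Weights.transition, RCLike.star_def, map_inv₀,
    Complex.conj_ofReal, Complex.conj_conj]
  rw [W.cond_symm t.1 s.1]
  have h1 : ∀ x, (Real.sqrt (W.duality x) : ℂ) ≠ 0 := fun x => by
    exact_mod_cast (Real.sqrt_pos.2 (W.duality_pos hG x)).ne'
  have h2 : ∀ x, (W.duality x : ℂ) = (Real.sqrt (W.duality x) : ℂ) ^ 2 := fun x => by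
    exact_mod_cast (Real.sq_sqrt (W.duality_nonneg x)).symm
  push_cast
  rw [h2 s.1, h2 t.1]
  have := h1 s.1
  have := h1 t.1
  field_simp

theorem hasSum_log_det (hG : G.Connected) (W : Weights G) (hp : p ≠ 2)
    {h : Matrix (Fin r) (Fin r) (ZMod p)} (hh : h.transpose = -h) (e : Fin r → G.Dart) :
    HasSum (fun w : BasedLoop G => (w.weight W : ℂ) *
      (LinearMap.toMatrix' (schrodinger h (holonomy p e w.darts))).trace)
      (-Complex.log (1 - extendedTransition W e h).det) := by
  classical
  set τ : List G.Dart → ℂ := fun L =>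
    (LinearMap.toMatrix' (schrodinger h (holonomy p e L))).trace with hτ
  have hτle : ∀ L, ‖τ L‖ ≤ (p : ℝ) ^ r := fun L => norm_trace_schrodinger_le h _
  obtain ⟨D, hD⟩ := exists_units_conj_symmetrization hG W e h
  have htrace : ∀ n, (symmetrization W e h ^ n).trace = (extendedTransition W e h ^ n).trace := by
    intro n
    rw [hD, Units.conj_pow, Matrix.trace_units_conj]
  have hdet : (1 - symmetrization W e h).det = (1 - extendedTransition W e h).det := by
    have h1 : 1 - symmetrization W e h = D.val * (1 - extendedTransition W e h) * D⁻¹.val := by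
      rw [hD, mul_sub, sub_mul, mul_one, Units.mul_inv]
    rw [h1, Matrix.det_units_conj]
  have htendsto : Tendsto (fun n => (symmetrization W e h ^ n).trace) atTop (𝓝 0) := by
    have hs : Summable fun n => (p : ℝ) ^ r * ∑ x, W.survival n x :=
      (summable_sum fun x _ => W.summable_survival hG x).mul_left _
    refine squeeze_zero_norm (fun n => ?_) hs.tendsto_atTop_zero
    rw [htrace, trace_extendedTransition_pow W hp hh, Finset.mul_sum]
    refine (norm_sum_le _ _).trans (Finset.sum_le_sum fun x _ => ?_)
    refine (norm_sum_le _ _).trans ?_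
    refine le_trans (Finset.sum_le_sum fun w _ => ?_)
      ((Finset.mul_sum _ _ _).symm.le.trans
        (mul_le_mul_of_nonneg_left (W.sum_dartProd_le n x) (by positivity)))
    rw [norm_mul, Complex.norm_real, Real.norm_of_nonneg (W.dartProd_nonneg _), mul_comm]
    exact mul_le_mul_of_nonneg_right (hτle _) (W.dartProd_nonneg _)
  have hsum := hasSum_trace_pow_div (isHermitian_symmetrization hG W hp hh e) htendsto
  rw [hdet] at hsum
  -- Absolute summability permits regrouping the based loops by length; the group of length n + 1
  -- gives tr(A^{n+1})/(n + 1).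
  have hsummable : Summable fun w : BasedLoop G => (w.weight W : ℂ) * τ w.darts := by
    refine Summable.of_norm_bounded ((summable_weight W hG).mul_right ((p : ℝ) ^ r)) fun w => ?_
    rw [norm_mul, Complex.norm_real, Real.norm_of_nonneg (w.weight_nonneg W)]
    exact mul_le_mul_of_nonneg_left (hτle _) (w.weight_nonneg W)
  have hfib : ∀ n : ℕ, HasSum (fun c => (((basedLoopEquiv G ⟨n, c⟩).weight W : ℝ) : ℂ) *
      τ (basedLoopEquiv G ⟨n, c⟩).darts) ((symmetrization W e h ^ (n + 1)).trace / (n + 1)) := by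
    intro n
    convert hasSum_fintype _ using 1
    rw [htrace, trace_extendedTransition_pow W hp hh, Fintype.sum_sigma, Finset.sum_div]
    refine Finset.sum_congr rfl fun x _ => ?_
    rw [Finset.sum_div, ← Finset.sum_coe_sort]
    refine Finset.sum_congr rfl fun w _ => ?_
    rw [basedLoopEquiv_weight, basedLoopEquiv_darts, hτ]
    push_cast
    ring
  have hsigma := ((basedLoopEquiv G).hasSum_iff.2 hsummable.hasSum).sigma hfib
  rw [← hsigma.unique hsum]
  exact hsummable.hasSum

end LogDetExpansion

/-! ### The limit along odd primes and its Fourier coefficients. -/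

section Limit

variable {r : ℕ}

/-- Applied to the entrywise product of two skew-symmetric matrices; the factor 2 cancels the ½ in
`skewOf`. -/
theorem sum_eq_two_mul_sum_pairs {R : Type*} [CommRing R] (f : Fin r → Fin r → R)
    (hsymm : ∀ i j, f i j = f j i) (hdiag : ∀ i, f i i = 0) :
    ∑ i, ∑ j, f i j = 2 * ∑ ij : Pairs r, f ij.1.1 ij.1.2 := by
  have h1 : ∀ i j, f i j = (if i < j then f i j else 0) + (if j < i then f j i else 0) := by
    intro i j
    rcases lt_trichotomy i j with h | h | h
    · rw [if_pos h, if_neg h.asymm, add_zero]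
    · subst h; simp [hdiag]
    · rw [if_neg h.asymm, if_pos h, zero_add, hsymm]
  have h2 : ∑ ij : Pairs r, f ij.1.1 ij.1.2 = ∑ i, ∑ j, if i < j then f i j else 0 := by
    rw [← Finset.sum_product', ← Finset.sum_filter, Finset.univ_product_univ]
    exact (Finset.sum_subtype (p := fun ij : Fin r × Fin r => ij.1 < ij.2) _
      (fun x => Finset.mem_filter_univ x) (fun ij => f ij.1 ij.2)).symm
  calc ∑ i, ∑ j, f i j
      = ∑ i, ∑ j, ((if i < j then f i j else 0) + (if j < i then f j i else 0)) :=
        Finset.sum_congr rfl fun i _ => Finset.sum_congr rfl fun j _ => h1 i j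
    _ = _ := by
      simp only [Finset.sum_add_distrib]
      rw [Finset.sum_comm (f := fun i j => if j < i then f j i else 0), ← h2]
      ring

theorem transpose_skewOf (p : ℕ) (u : Pairs r → ℝ) :
    (skewOf p u).transpose = -skewOf p u := by
  ext i j
  simp only [Matrix.transpose_apply, Matrix.neg_apply, skewOf]
  rcases lt_trichotomy i j with h | h | h
  · rw [dif_pos h, dif_neg h.asymm, dif_pos h]
  · subst h; simp
  · rw [dif_pos h, dif_neg h.asymm, dif_pos h, neg_neg]

variable {V : Type*} [DecidableEq V] {G : SimpleGraph V}

/-- The phase `exp (2π√-1 ∑_{i<j} u_{i,j} Ň_{i,j})` of a based loop whose homology class vanishes,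
and zero for the other based loops. -/
def phase (e : Fin r → G.Dart) (u : Pairs r → ℝ) (L : List G.Dart) : ℂ :=
  if ∀ i, flux (e i) L = 0 then
    ∏ ij : Pairs r, Complex.exp (2 * Real.pi * Complex.I * area (e ij.1.1) (e ij.1.2) L * u ij)
  else 0

theorem norm_phase_le (e : Fin r → G.Dart) (u : Pairs r → ℝ) (L : List G.Dart) :
    ‖phase e u L‖ ≤ 1 := by
  rw [phase]
  split_ifs
  · rw [norm_prod]
    refine Finset.prod_le_one (fun _ _ => norm_nonneg _) fun ij _ => ?_
    rw [Complex.norm_exp]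
    simp
  · simp

theorem continuous_phase (e : Fin r → G.Dart) (L : List G.Dart) :
    Continuous fun u => phase e u L := by
  unfold phase
  split_ifs
  · fun_prop
  · exact continuous_const

theorem trace_holonomy_eq {p : ℕ} [NeZero p] [Fact p.Prime] (hp : p ≠ 2) {e : Fin r → G.Dart}
    (he : Function.Injective fun i => (e i).edge) (u : Pairs r → ℝ) {L : List G.Dart}
    (hL : ∀ i, flux (e i) L = 0) :
    (LinearMap.toMatrix' (schrodinger (skewOf p u) (holonomy p e L))).trace =
      (p : ℂ) ^ r * ∏ ij : Pairs r, Complex.exp (2 * Real.pi * Complex.I *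
        area (e ij.1.1) (e ij.1.2) L * ((⌊(p : ℝ) * u ij⌋ : ℝ) / (p : ℝ) : ℝ)) := by
  have ha : (holonomy p e L).a = 0 := by
    ext i; rw [holonomy_a, hL, Int.cast_zero]; rfl
  have h2 := two_ne_zero_of_odd_prime hp
  have hskew : ∀ i j, skewOf p u j i = - skewOf p u i j := fun i j =>
    congrFun (congrFun (transpose_skewOf p u) i) j
  have hc : ∀ i j, i < j →
      (holonomy p e L).c i j = (area (e i) (e j) L : ZMod p) := by
    intro i j hij
    rw [holonomy_c, area_swap (fun h => hij.ne (he h)) (hL i)]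
    push_cast
    field_simp
    ring
  have hcskew : ∀ i j, (holonomy p e L).c j i = - (holonomy p e L).c i j := fun i j =>
    congrFun (congrFun (holonomy p e L).skew i) j
  rw [trace_schrodinger_of_eq_zero _ ha, sum_eq_two_mul_sum_pairs]
  · have hsum : 2 * ∑ ij : Pairs r, skewOf p u ij.1.1 ij.1.2 * (holonomy p e L).c ij.1.1 ij.1.2 =
        ((∑ ij : Pairs r, ⌊(p : ℝ) * u ij⌋ * area (e ij.1.1) (e ij.1.2) L : ℤ) : ZMod p) := by
      push_cast
      rw [Finset.mul_sum]
      refine Finset.sum_congr rfl fun ij _ => ?_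
      rw [hc _ _ ij.2, skewOf, dif_pos ij.2]
      field_simp
    rw [hsum, ZMod.stdAddChar_coe, ← Complex.exp_sum]
    congr 2
    push_cast
    rw [Finset.mul_sum, Finset.sum_div]
    refine Finset.sum_congr rfl fun ij _ => ?_
    ring
  · intro i j
    rw [hskew, hcskew]; ring
  · intro i
    simp [skewOf]

instance : Nonempty OddPrime := ⟨⟨3, Nat.prime_three, by norm_num⟩⟩

theorem tendsto_val_oddPrime : Tendsto (fun p : OddPrime => (p : ℕ)) atTop atTop := by
  refine tendsto_atTop_atTop.2 fun b => ?_
  obtain ⟨q, hq, hq'⟩ := Nat.exists_infinite_primes (max b 3)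
  have h3 : 3 ≤ q := (le_max_right _ _).trans hq
  exact ⟨⟨q, hq', by omega⟩, fun p hp => ((le_max_left _ _).trans hq).trans hp⟩

theorem tendsto_trace_holonomy {e : Fin r → G.Dart}
    (he : Function.Injective fun i => (e i).edge) (u : Pairs r → ℝ) (L : List G.Dart) :
    Tendsto (fun p : OddPrime => (1 / ((p : ℕ) : ℂ) ^ r) *
      (LinearMap.toMatrix' (schrodinger (skewOf (p : ℕ) u) (holonomy (p : ℕ) e L))).trace)
      atTop (𝓝 (phase e u L)) := by
  rw [phase]
  split_ifs with hL
  · have hfloor : ∀ x : ℝ, Tendsto (fun p : OddPrime =>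
        (⌊((p : ℕ) : ℝ) * x⌋ : ℝ) / ((p : ℕ) : ℝ)) atTop (𝓝 x) := by
      intro x
      have hinv : Tendsto (fun p : OddPrime => x - 1 / ((p : ℕ) : ℝ)) atTop (𝓝 x) := by
        simpa using tendsto_const_nhds.sub
          (tendsto_one_div_atTop_nhds_zero_nat (𝕜 := ℝ) |>.comp tendsto_val_oddPrime)
      refine tendsto_of_tendsto_of_tendsto_of_le_of_le hinv tendsto_const_nhds ?_ ?_
      · intro p
        have hp0 : (0 : ℝ) < ((p : ℕ) : ℝ) := by exact_mod_cast p.2.1.pos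
        have := Int.lt_floor_add_one (((p : ℕ) : ℝ) * x)
        change x - 1 / ((p : ℕ) : ℝ) ≤ _
        rw [le_div_iff₀ hp0, sub_mul, one_div, inv_mul_cancel₀ hp0.ne']
        linarith
      · intro p
        have hp0 : (0 : ℝ) < ((p : ℕ) : ℝ) := by exact_mod_cast p.2.1.pos
        have := Int.floor_le (((p : ℕ) : ℝ) * x)
        change (⌊((p : ℕ) : ℝ) * x⌋ : ℝ) / ((p : ℕ) : ℝ) ≤ x
        rw [div_le_iff₀ hp0]
        linarith
    have hprod : Tendsto (fun p : OddPrime => ∏ ij : Pairs r, Complex.exp (2 * Real.pi * Complex.I *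
        area (e ij.1.1) (e ij.1.2) L * ((⌊((p : ℕ) : ℝ) * u ij⌋ : ℝ) / ((p : ℕ) : ℝ) : ℝ))) atTop
        (𝓝 (∏ ij : Pairs r, Complex.exp (2 * Real.pi * Complex.I *
          area (e ij.1.1) (e ij.1.2) L * u ij))) := by
      refine tendsto_finsetProd _ fun ij _ => ?_
      exact (Complex.continuous_exp.tendsto _).comp
        (((Complex.continuous_ofReal.tendsto _).comp (hfloor (u ij))).const_mul _)
    refine hprod.congr fun p => ?_
    have : Fact (p : ℕ).Prime := ⟨p.2.1⟩
    rw [trace_holonomy_eq p.2.2 he u hL]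
    have hp0 : ((p : ℕ) : ℂ) ^ r ≠ 0 := pow_ne_zero _ (by exact_mod_cast p.2.1.ne_zero)
    field_simp
  · push Not at hL
    obtain ⟨i, hi⟩ := hL
    refine tendsto_const_nhds.congr' ?_
    -- A prime exceeding the absolute value of a nonzero flux does not divide it, so the trace is
    -- eventually zero.
    filter_upwards [tendsto_val_oddPrime.eventually_gt_atTop (flux (e i) L).natAbs] with p hp
    rw [trace_schrodinger_of_ne_zero, mul_zero]
    intro h0
    have h1 := congrFun h0 i
    rw [holonomy_a, Pi.zero_apply, ZMod.intCast_zmod_eq_zero_iff_dvd] at h1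
    exact absurd (Int.eq_zero_of_dvd_of_natAbs_lt_natAbs h1 (by simpa using hp)) hi

variable [Fintype V]

/-- The limit of the normalized logarithms of determinants. -/
def limitLogDet (W : Weights G) (e : Fin r → G.Dart) (u : Pairs r → ℝ) : ℂ :=
  -∑' w : BasedLoop G, (w.weight W : ℂ) * phase e u w.darts

theorem norm_weight_mul_phase_le (W : Weights G) (e : Fin r → G.Dart) (u : Pairs r → ℝ)
    (w : BasedLoop G) : ‖(w.weight W : ℂ) * phase e u w.darts‖ ≤ w.weight W := by
  rw [norm_mul, Complex.norm_real, Real.norm_of_nonneg (w.weight_nonneg W)]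
  exact mul_le_of_le_one_right (w.weight_nonneg W) (norm_phase_le e u _)

/-- Termwise convergence suffices: after division by p^r the traces are bounded by 1, so the weights
dominate. -/
theorem tendsto_normalizedLogDet (hG : G.Connected) (W : Weights G) {e : Fin r → G.Dart}
    (he : Function.Injective fun i => (e i).edge) (u : Pairs r → ℝ) :
    Tendsto (fun p => normalizedLogDet W e u p) atTop (𝓝 (limitLogDet W e u)) := by
  classical
  have hlog : ∀ p : OddPrime, normalizedLogDet W e u p = -∑' w : BasedLoop G, (w.weight W : ℂ) *
      ((1 / ((p : ℕ) : ℂ) ^ r) * (LinearMap.toMatrix' (schrodinger (skewOf (p : ℕ) u)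
        (holonomy (p : ℕ) e w.darts))).trace) := by
    intro p
    have : Fact (p : ℕ).Prime := ⟨p.2.1⟩
    have h := (hasSum_log_det hG W p.2.2 (transpose_skewOf (p : ℕ) u) e).mul_left
      (1 / ((p : ℕ) : ℂ) ^ r)
    rw [normalizedLogDet, ← neg_inj, neg_neg, ← mul_neg, ← h.tsum_eq]
    exact tsum_congr fun w => mul_left_comm _ _ _
  simp only [hlog]
  refine Tendsto.neg ?_
  refine tendsto_tsum_of_dominated_convergence (summable_weight W hG)
    (fun w => (tendsto_trace_holonomy he u w.darts).const_mul _) ?_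
  refine Eventually.of_forall fun p w => ?_
  rw [norm_mul, Complex.norm_real, Real.norm_of_nonneg (w.weight_nonneg W)]
  refine mul_le_of_le_one_right (w.weight_nonneg W) ?_
  have hp0 : (0 : ℝ) < ((p : ℕ) : ℝ) ^ r := pow_pos (by exact_mod_cast p.2.1.pos) _
  rw [norm_mul, norm_div, norm_one, norm_pow, Complex.norm_natCast, one_div,
    inv_mul_le_iff₀ hp0, mul_one]
  exact norm_trace_schrodinger_le _ _

theorem continuous_limitLogDet (hG : G.Connected) (W : Weights G) (e : Fin r → G.Dart) :
    Continuous (limitLogDet W e) := by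
  classical
  have h : Continuous fun u => ∑' w : BasedLoop G, (w.weight W : ℂ) * phase e u w.darts :=
    continuous_tsum (fun w => continuous_const.mul (continuous_phase e w.darts))
      (summable_weight W hG) fun w u => norm_weight_mul_phase_le W e u w
  exact h.neg

theorem integral_exp_unit (k : ℤ) :
    ∫ x in Set.Icc (0 : ℝ) 1, Complex.exp (2 * Real.pi * Complex.I * k * x) =
      if k = 0 then 1 else 0 := by
  rw [integral_Icc_eq_integral_Ioc, ← intervalIntegral.integral_of_le zero_le_one]
  split_ifs with hk
  · simp [hk]
  · have hc : 2 * Real.pi * Complex.I * k ≠ 0 := by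
      simp [Real.pi_ne_zero, hk]
    rw [integral_exp_mul_complex hc]
    have h1 : 2 * Real.pi * Complex.I * k * ((1 : ℝ) : ℂ) = k * (2 * Real.pi * Complex.I) := by
      push_cast; ring
    rw [h1, Complex.exp_int_mul_two_pi_mul_I]
    simp

theorem integral_exp_box {ι : Type*} [Fintype ι] (k : ι → ℤ) :
    ∫ u in Set.Icc (0 : ι → ℝ) 1, ∏ i, Complex.exp (2 * Real.pi * Complex.I * k i * u i) =
      if k = 0 then 1 else 0 := by
  rw [← Set.pi_univ_Icc, volume_pi, Measure.restrict_pi_pi,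
    integral_fintype_prod_eq_prod (f := fun i (x : ℝ) =>
      Complex.exp (2 * Real.pi * Complex.I * k i * x))]
  simp only [Pi.zero_apply, Pi.one_apply, integral_exp_unit]
  split_ifs with hk
  · exact Finset.prod_eq_one fun i _ => if_pos (congrFun hk i)
  · obtain ⟨i, hi⟩ := Function.ne_iff.1 hk
    exact Finset.prod_eq_zero (Finset.mem_univ i) (if_neg hi)

/-- Sum and integral are exchanged by domination; orthogonality of the exponentials on the cube then
retains exactly the based loops with areas `m`. -/
theorem integral_limitLogDet (hG : G.Connected) (W : Weights G) (e : Fin r → G.Dart)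
    (m : Pairs r → ℤ) :
    ∫ u in Set.Icc (0 : Pairs r → ℝ) 1, limitLogDet W e u *
        ∏ ij, Complex.exp (-2 * Real.pi * Complex.I * m ij * u ij) =
      -∑' w : BasedLoop G, if (∀ i, flux (e i) w.darts = 0) ∧
        ∀ ij : Pairs r, area (e ij.1.1) (e ij.1.2) w.darts = m ij then (w.weight W : ℂ) else 0 := by
  classical
  have hnorm : ∀ u : Pairs r → ℝ,
      ‖∏ ij, Complex.exp (-2 * Real.pi * Complex.I * m ij * u ij)‖ = 1 := by
    intro u
    rw [norm_prod]
    refine Finset.prod_eq_one fun ij _ => ?_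
    rw [Complex.norm_exp]
    simp
  let f : BasedLoop G → (Pairs r → ℝ) → ℂ := fun w u => (w.weight W : ℂ) * phase e u w.darts *
    ∏ ij, Complex.exp (-2 * Real.pi * Complex.I * m ij * u ij)
  have hcont : ∀ w, Continuous (f w) := fun w =>
    (continuous_const.mul (continuous_phase e w.darts)).mul (by fun_prop)
  have hint : ∀ w, Integrable (f w) (volume.restrict (Set.Icc (0 : Pairs r → ℝ) 1)) := fun w =>
    (hcont w).continuousOn.integrableOn_compact isCompact_Icc
  have hle : ∀ w u, ‖f w u‖ ≤ w.weight W := fun w u => by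
    rw [norm_mul, hnorm, mul_one]
    exact norm_weight_mul_phase_le W e u w
  have hvol : (volume.restrict (Set.Icc (0 : Pairs r → ℝ) 1)).real Set.univ = 1 := by
    rw [Measure.real, Measure.restrict_apply_univ, Real.volume_Icc_pi]
    simp
  have : IsFiniteMeasure (volume.restrict (Set.Icc (0 : Pairs r → ℝ) 1)) :=
    isFiniteMeasure_restrict.2 isCompact_Icc.measure_ne_top
  have hsum : Summable fun w => ∫ u in Set.Icc (0 : Pairs r → ℝ) 1, ‖f w u‖ := by
    refine Summable.of_nonneg_of_le (fun w => integral_nonneg fun u => norm_nonneg _)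
      (fun w => ?_) (summable_weight W hG)
    have h := integral_mono (hint w).norm (integrable_const (w.weight W)) (hle w)
    rwa [integral_const, hvol, one_smul] at h
  have hmain := integral_tsum_of_summable_integral_norm hint hsum
  have hval : ∀ w, ∫ u in Set.Icc (0 : Pairs r → ℝ) 1, f w u =
      if (∀ i, flux (e i) w.darts = 0) ∧
        ∀ ij : Pairs r, area (e ij.1.1) (e ij.1.2) w.darts = m ij then (w.weight W : ℂ) else 0 := by
    intro w
    by_cases hw : ∀ i, flux (e i) w.darts = 0
    · have hf : ∀ u, f w u = (w.weight W : ℂ) * ∏ ij : Pairs r, Complex.exp (2 * Real.pi *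
          Complex.I * ((area (e ij.1.1) (e ij.1.2) w.darts - m ij : ℤ) : ℂ) * u ij) := by
        intro u
        simp only [f, phase, if_pos hw]
        rw [mul_assoc, ← Finset.prod_mul_distrib]
        congr 1
        refine Finset.prod_congr rfl fun ij _ => ?_
        rw [← Complex.exp_add]
        congr 1
        push_cast
        ring
      simp only [hf]
      rw [integral_const_mul, integral_exp_box
        (fun ij : Pairs r => area (e ij.1.1) (e ij.1.2) w.darts - m ij)]
      simp only [hw, implies_true, true_and, funext_iff, Pi.zero_apply, sub_eq_zero, mul_ite,
        mul_one, mul_zero]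
    · rw [if_neg fun h => hw h.1]
      simp [f, phase, if_neg hw]
  simp only [hval] at hmain
  rw [hmain, ← integral_neg]
  refine integral_congr_ae (Eventually.of_forall fun u => ?_)
  simp only [limitLogDet, f, neg_mul, tsum_mul_right]

end Limit

/-! ### Independence by blocks and countable sums of Poisson variables. -/

section Poisson

variable {Ω : Type*} [mΩ : MeasurableSpace Ω] {Pr : Measure Ω}

/-- Variables which are functions of disjoint blocks of independent variables are independent. -/
theorem iIndepFun_of_disjoint_blocks [IsProbabilityMeasure Pr] {ι κ β γ : Type*}
    [mβ : MeasurableSpace β] [mγ : MeasurableSpace γ] {X : ι → Ω → β} (hX : ∀ i, Measurable (X i))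
    (hindep : iIndepFun X Pr) {S : κ → Set ι} (hS : Pairwise fun k k' => Disjoint (S k) (S k'))
    {Y : κ → Ω → γ} (hY : ∀ k, Measurable[⨆ i ∈ S k, mβ.comap (X i)] (Y k)) :
    iIndepFun Y Pr := by
  classical
  rw [iIndepFun_iff]
  intro s f
  induction s using Finset.induction_on with
  | empty => simp
  | insert k s hk ih =>
    intro hf
    have hdisj : Disjoint (S k) (⋃ k' ∈ s, S k') := by
      simp only [Set.disjoint_iUnion_right]
      intro k' hk'
      exact hS fun h => hk (h ▸ hk')
    have h := indep_iSup_of_disjoint (fun i => (hX i).comap_le) hindep.iIndep hdisj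
    rw [Finset.set_biInter_insert, Finset.prod_insert hk,
      ← ih fun i hi => hf i (Finset.mem_insert_of_mem hi)]
    -- The event of the new block is independent of the intersection of the others, which lives on
    -- the union of their index sets.
    refine (Indep_iff _ _ _).1 h _ _ ?_ ?_
    · obtain ⟨t, ht, hft⟩ := hf k (Finset.mem_insert_self _ _)
      rw [← hft]
      exact hY k ht
    · refine Finset.measurableSet_biInter _ fun k' hk' => ?_
      obtain ⟨t, ht, hft⟩ := hf k' (Finset.mem_insert_of_mem hk')
      rw [← hft]
      refine (iSup₂_mono' fun i hi => ⟨i, Set.mem_biUnion hk' hi, le_rfl⟩ :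
        (⨆ i ∈ S k', mβ.comap (X i)) ≤ ⨆ i ∈ ⋃ k' ∈ s, S k', mβ.comap (X i)) _ (hY k' ht)

theorem poissonMeasure_zero : poissonMeasure 0 = Measure.dirac 0 := by
  refine Measure.ext_of_singleton fun n => ?_
  rw [poissonMeasure_singleton]
  cases n <;> simp

theorem hasLaw_sum_poisson [IsProbabilityMeasure Pr] {ι : Type*} {X : ι → Ω → ℕ}
    (hX : ∀ i, Measurable (X i)) (hindep : iIndepFun X Pr) {r : ι → ℝ≥0}
    (hlaw : ∀ i, HasLaw (X i) (poissonMeasure (r i)) Pr) (s : Finset ι) :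
    HasLaw (∑ i ∈ s, X i) (poissonMeasure (∑ i ∈ s, r i)) Pr := by
  classical
  induction s using Finset.induction_on with
  | empty =>
    rw [Finset.sum_empty, Finset.sum_empty, poissonMeasure_zero]
    exact hasLaw_dirac_of_ae_eq (Eventually.of_forall fun _ => rfl)
  | insert i s hi ih =>
    rw [Finset.sum_insert hi, Finset.sum_insert hi, add_comm, add_comm (r i)]
    exact (hindep.indepFun_finsetSum_of_notMem hX hi).hasLaw_add_poissonMeasure ih (hlaw i)

theorem continuous_poissonMeasure_Iic (n : ℕ) :
    Continuous fun r : ℝ≥0 => poissonMeasure r (Set.Iic n) := by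
  have h : ∀ r : ℝ≥0, poissonMeasure r (Set.Iic n) = ∑ k ∈ Finset.Iic n,
      ENNReal.ofReal (Real.exp (-r) * r ^ k / (k.factorial)) := by
    intro r
    rw [← Finset.coe_Iic, ← sum_measure_singleton]
    simp only [poissonMeasure_singleton]
  simp only [h]
  exact continuous_finsetSum _ fun k _ => ENNReal.continuous_ofReal.comp (by fun_prop)

/-- A countable sum of independent Poisson variables with summable means is a Poisson variable. -/
theorem hasLaw_tsum_poisson [IsProbabilityMeasure Pr] {ι : Type*} [Countable ι] {X : ι → Ω → ℕ}
    (hX : ∀ i, Measurable (X i)) (hindep : iIndepFun X Pr) {r : ι → ℝ≥0}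
    (hlaw : ∀ i, HasLaw (X i) (poissonMeasure (r i)) Pr) {m : ℝ≥0} (hm : HasSum r m) :
    HasLaw (fun ω => ∑' i, (X i ω : ℝ≥0∞))
      ((poissonMeasure m).map (fun n : ℕ => (n : ℝ≥0∞))) Pr := by
  have hmeas : Measurable fun ω => ∑' i, (X i ω : ℝ≥0∞) :=
    Measurable.tsum fun i => (measurable_from_nat).comp (hX i)
  have hcast : Measurable fun n : ℕ => (n : ℝ≥0∞) := measurable_from_nat
  refine ⟨hmeas.aemeasurable, ?_⟩
  have : IsProbabilityMeasure (Pr.map fun ω => ∑' i, (X i ω : ℝ≥0∞)) :=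
    Measure.isProbabilityMeasure_map hmeas.aemeasurable
  have : IsProbabilityMeasure ((poissonMeasure m).map (fun n : ℕ => (n : ℝ≥0∞))) :=
    Measure.isProbabilityMeasure_map hcast.aemeasurable
  -- Distribution functions are compared on [0, ∞]: the sum is at most b exactly when all finite
  -- partial sums are at most ⌊b⌋. Continuity from above and continuity of the Poisson distribution
  -- function in its mean give the limit.
  refine Measure.ext_of_Iic _ _ fun a => ?_
  by_cases ha : a = ⊤
  · rw [ha, Set.Iic_top, measure_univ, measure_univ]
  lift a to ℝ≥0 using ha with b
  have hfloor : ∀ n : ℕ, (n : ℝ≥0∞) ≤ b ↔ n ≤ ⌊b⌋₊ := by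
    intro n
    rw [Nat.le_floor_iff zero_le]
    exact_mod_cast Iff.rfl
  rw [Measure.map_apply hmeas measurableSet_Iic, Measure.map_apply hcast measurableSet_Iic]
  have h1 : (fun ω => ∑' i, (X i ω : ℝ≥0∞)) ⁻¹' Set.Iic (b : ℝ≥0∞) =
      ⋂ s : Finset ι, {ω | (∑ i ∈ s, X i) ω ≤ ⌊b⌋₊} := by
    ext ω
    simp only [Set.mem_preimage, Set.mem_Iic, Set.mem_iInter, Set.mem_ofPred_eq,
      ENNReal.tsum_eq_iSup_sum, iSup_le_iff, Finset.sum_apply, ← hfloor, Nat.cast_sum]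
  have h2 : (fun n : ℕ => (n : ℝ≥0∞)) ⁻¹' Set.Iic (b : ℝ≥0∞) = Set.Iic ⌊b⌋₊ := by
    ext n
    simp [← hfloor]
  rw [h1, h2]
  have hmeas' : ∀ s : Finset ι, Measurable (∑ i ∈ s, X i) := fun s => by
    rw [Finset.sum_fn]
    exact Finset.measurable_sum s fun i _ => hX i
  have hanti : Antitone fun s : Finset ι => {ω | (∑ i ∈ s, X i) ω ≤ ⌊b⌋₊} := by
    intro s t hst ω hω
    simp only [Set.mem_ofPred_eq, Finset.sum_apply] at hω ⊢
    exact (Finset.sum_le_sum_of_subset hst).trans hω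
  have hlim := tendsto_measure_iInter_atTop (μ := Pr)
    (fun s => (measurableSet_le (hmeas' s) measurable_const).nullMeasurableSet) hanti
    ⟨∅, measure_ne_top _ _⟩
  refine tendsto_nhds_unique hlim ?_
  have hlim' := ((continuous_poissonMeasure_Iic ⌊b⌋₊).tendsto m).comp hm
  refine hlim'.congr fun s => ?_
  exact ((hasLaw_sum_poisson hX hindep hlaw s).measure_eq (measurableSet_Iic (a := ⌊b⌋₊))).symm

end Poisson

/-! ### Counts of loops in the Poisson ensemble. -/

section Ensemble

theorem disjoint_loopsWith {V : Type*} [DecidableEq V] {G : SimpleGraph V} {r : ℕ}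
    {e : Fin r → G.Dart} {m m' : Pairs r → ℤ} (h : m ≠ m') :
    Disjoint (loopsWith e m) (loopsWith e m') := by
  rw [Set.disjoint_left]
  rintro l ⟨-, hl⟩ ⟨-, hl'⟩
  obtain ⟨w, hw⟩ : ∃ w : BasedLoop G, w.toLoop = l := Quotient.exists_rep l
  exact h (funext fun ij => (hl w hw ij).symm.trans (hl' w hw ij))

variable {V : Type*} [Fintype V] {G : SimpleGraph V}
  {W : Weights G} {α : ℝ≥0} {Ω : Type*} [MeasurableSpace Ω] {Pr : Measure Ω}
  [IsProbabilityMeasure Pr] {N : Loop G → Ω → ℕ}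

theorem iIndepFun_count (hN : IsPoissonEnsemble W Pr α N) {κ : Type*} {A : κ → Set (Loop G)}
    (hA : Pairwise fun k k' => Disjoint (A k) (A k')) :
    iIndepFun (fun k => count N (A k)) Pr := by
  refine iIndepFun_of_disjoint_blocks hN.measurable hN.indep hA fun k => ?_
  -- Ω is given the σ-algebra of the block, so that measurability of the count expresses its
  -- dependence on that block only.
  let _ : MeasurableSpace Ω := ⨆ l ∈ A k, (inferInstance : MeasurableSpace ℕ).comap (N l)
  refine Measurable.tsum fun l => ?_
  refine measurable_from_nat.comp ?_
  exact (comap_measurable (N l)).mono (le_iSup₂_of_le l.1 l.2 le_rfl) le_rfl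

theorem hasLaw_count (hN : IsPoissonEnsemble W Pr α N) {A : Set (Loop G)} {mean : ℝ≥0}
    (hmean : (mean : ℝ≥0∞) = α * loopMeasure W A) :
    HasLaw (count N A) ((poissonMeasure mean).map (fun n : ℕ => (n : ℝ≥0∞))) Pr := by
  refine hasLaw_tsum_poisson (X := fun l : A => N l) (fun l => hN.measurable l)
    (hN.indep.precomp Subtype.val_injective) (fun l => hN.law l) ?_
  rw [← ENNReal.hasSum_coe, hmean, loopMeasure_apply_eq_tsum_loop, ← tsum_subtype]
  simp only [ENNReal.coe_mul]
  rw [← ENNReal.tsum_mul_left]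
  exact ENNReal.summable.hasSum

variable [DecidableEq V] {T : SimpleGraph V} {r : ℕ} {e : Fin r → G.Dart}

theorem loopMeasure_loopsWith (hG : G.Connected) (hTG : T ≤ G) (hT : T.IsTree)
    (he : Set.BijOn (fun i => (e i).edge) Set.univ (G.edgeSet \ T.edgeSet)) (W : Weights G)
    (m : Pairs r → ℤ) :
    loopMeasure W (loopsWith e m) = ENNReal.ofReal (∑' w : BasedLoop G,
      if (∀ i, flux (e i) w.darts = 0) ∧
        ∀ ij : Pairs r, area (e ij.1.1) (e ij.1.2) w.darts = m ij then w.weight W else 0) := by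
  classical
  rw [loopMeasure_apply_eq_tsum, ENNReal.ofReal_tsum_of_nonneg]
  · refine tsum_congr fun w => ?_
    rw [Set.indicator_apply, Set.mem_preimage, toLoop_mem_loopsWith_iff hTG hT he]
    split_ifs <;> simp
  · intro w
    split_ifs
    exacts [w.weight_nonneg W, le_rfl]
  · refine Summable.of_nonneg_of_le (fun w => ?_) (fun w => ?_) (summable_weight W hG)
    · split_ifs
      exacts [w.weight_nonneg W, le_rfl]
    · split_ifs
      exacts [le_rfl, w.weight_nonneg W]

end Ensemble

end LoopEnsemble

end

theorem theorem4 {V : Type*} [Fintype V] [DecidableEq V]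
    (G T : SimpleGraph V) (hG : G.Connected) (hTG : T ≤ G) (hT : T.IsTree)
    {r : ℕ} (e : Fin r → G.Dart)
    (he : Set.BijOn (fun i => (e i).edge) Set.univ (G.edgeSet \ T.edgeSet))
    (W : LoopEnsemble.Weights G) (α : ℝ≥0)
    {Ω : Type*} [MeasurableSpace Ω] (Pr : Measure Ω) [IsProbabilityMeasure Pr]
    (N : LoopEnsemble.Loop G → Ω → ℕ) (hN : LoopEnsemble.IsPoissonEnsemble W Pr α N) :
    ∃ F : (LoopEnsemble.Pairs r → ℝ) → ℂ,
      (∀ u ∈ Set.Icc (0 : LoopEnsemble.Pairs r → ℝ) 1,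
        Tendsto (fun p => LoopEnsemble.normalizedLogDet W e u p) atTop (𝓝 (F u))) ∧
      IntegrableOn F (Set.Icc 0 1) ∧
      iIndepFun (fun m : LoopEnsemble.Pairs r → ℤ =>
        LoopEnsemble.count N (LoopEnsemble.loopsWith e m)) Pr ∧
      ∀ m : LoopEnsemble.Pairs r → ℤ, ∃ mean : ℝ≥0,
        HasLaw (LoopEnsemble.count N (LoopEnsemble.loopsWith e m))
          ((poissonMeasure mean).map (fun n : ℕ => (n : ℝ≥0∞))) Pr ∧
        (mean : ℝ≥0∞) = α * LoopEnsemble.loopMeasure W (LoopEnsemble.loopsWith e m) ∧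
        ((mean : ℝ) : ℂ) = -(α : ℝ) * ∫ u in Set.Icc (0 : LoopEnsemble.Pairs r → ℝ) 1,
          F u * ∏ ij, Complex.exp (-2 * Real.pi * Complex.I * (m ij) * (u ij)) := by
  have hinj : Function.Injective fun i => (e i).edge := Set.injOn_univ.1 he.injOn
  refine ⟨LoopEnsemble.limitLogDet W e,
    fun u _ => LoopEnsemble.tendsto_normalizedLogDet hG W hinj u,
    (LoopEnsemble.continuous_limitLogDet hG W e).continuousOn.integrableOn_compact isCompact_Icc,
    LoopEnsemble.iIndepFun_count hN fun m m' h => LoopEnsemble.disjoint_loopsWith h, fun m => ?_⟩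
  have hμ := LoopEnsemble.loopMeasure_loopsWith hG hTG hT he W m
  -- The total mass is finite, being the image of a real number, so the mean may be taken in `ℝ≥0`.
  have hmean : ((α * (LoopEnsemble.loopMeasure W (LoopEnsemble.loopsWith e m)).toNNReal : ℝ≥0) :
      ℝ≥0∞) = α * LoopEnsemble.loopMeasure W (LoopEnsemble.loopsWith e m) := by
    rw [ENNReal.coe_mul, ENNReal.coe_toNNReal (hμ ▸ ENNReal.ofReal_ne_top)]
  refine ⟨_, LoopEnsemble.hasLaw_count hN hmean, hmean, ?_⟩
  rw [LoopEnsemble.integral_limitLogDet hG W e m, hμ, neg_mul_neg, NNReal.coe_mul,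
    Complex.ofReal_mul]
  congr 1
  change ((ENNReal.toReal (ENNReal.ofReal _) : ℝ) : ℂ) = _
  rw [ENNReal.toReal_ofReal, Complex.ofReal_tsum]
  · refine tsum_congr fun w => ?_
    split_ifs <;> simp
  · refine tsum_nonneg fun w => ?_
    split_ifs
    exacts [w.weight_nonneg W, le_rfl]
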